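/- Let $(\Omega,\mathcal A,\mathbb P)$ be a probability space, $T>0$, $\mathbb T=[0,T]$, $H\in(0,1)$, and let $\mathbb S^2\subset\mathbb R^3$ be the unit sphere with its surface measure and the geodesic distance $d_{\mathbb S^2}(x,y)=\arccos\langle x,y\rangle_{\mathbb R^3}$. Let $(Y_{\ell,m})_{\ell\in\mathbb N_0,\,-\ell\le m\le\ell}$ be real-valued spherical harmonics forming an orthonormal basis of $L^2(\mathbb S^2)$, where $Y_{\ell,m}$ has degree $\ell$. Let $\eta>0$ and let $A_\ell\ge 0$ $(\ell\in\mathbb N_0)$ satisfy $\sum_{\ell=0}^\infty A_\ell\,\ell^{1+\eta}<\infty$. Let $Q$ be the operator on $L^2(\mathbb S^2)$ with $QY_{\ell,m}=A_\ell Y_{\ell,m}$, that is, $Qu=\sum_{\ell,m}A_\ell\langle Y_{\ell,m},u\rangle Y_{\ell,m}$. Let $(B_Q^H(t))_{t\in\mathbb T}$ be an isotropic $Q$-fractional Brownian motion with Hurst parameter $H$: a continuous $L^2(\mathbb S^2)$-valued Gaussian process such that, for all $u,v\in L^2(\mathbb S^2)$ and $s,t\in\mathbb T$, $\mathbb E\langle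 B_Q^H(t),u\rangle=0$ and $$\mathbb E\big[\langle B_Q^H(t),u\rangle\langle B_Q^H(s),v\rangle\big]=\tfrac12\big(t^{2H}+s^{2H}-|t-s|^{2H}\big)\langle Qu,v\rangle .$$ Let $M=\mathbb T\times\mathbb S^2$ with the product metric $d_M((t,x),(s,y))=|t-s|+d_{\mathbb S^2}(x,y)$. Then, for every $(t,x)\in M$, the expansion $$B_Q^H(t,x)=\sum_{\ell=0}^\infty\sum_{m=-\ell}^{\ell}\langle B_Q^H(t),Y_{\ell,m}\rangle\,Y_{\ell,m}(x)$$ converges in $L^2(\Omega)$, and the resulting random field on $M$ has a continuous modification which is in $C^{\min\{H,\eta/2\}^-}(M)$. That is, there are random variables $Z(t,x)$, $(t,x)\in M$, such that - $\mathbb P\big(Z(t,x)=B_Q^H(t,x)\big)=1$ for every $(t,x)\in M$; - for every $\omega\in\Omega$, the function $Z(\cdot,\cdot)(\omega)$ is continuous on $M$ and, for every $\alpha$ with $0<\alpha<\min\{H,\eta/2\}$, there is a constant $C=C(\omega,\alpha)$ with $|Z(p)(\omega)-Z(q)(\omega)|\le C\,d_M(p,q)^\alpha$ for all $p,q\in M$.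 Moreover, for every $t\in\mathbb T$, almost surely $Z(t,\cdot)=B_Q^H(t)$ as elements of $L^2(\mathbb S^2)$. -/

import Mathlib

open MeasureTheory ProbabilityTheory Filter Topology

noncomputable section

namespace QfBm

/-- Three-dimensional Euclidean space. -/
abbrev E3 : Type := EuclideanSpace ℝ (Fin 3)

/-- The unit sphere `𝕊²` of `ℝ³`. -/
abbrev Sphere2 : Type := Metric.sphere (0 : E3) 1

/-- The surface measure of `𝕊²` (of total mass `4π`). -/
abbrev surfaceMeasure : Measure Sphere2 := (volume : Measure E3).toSphere

/-- The real Hilbert space `L²(𝕊²)`. -/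
abbrev L2Sphere : Type := Lp ℝ 2 surfaceMeasure

/-- `L²(𝕊²)` carries its Borel σ-algebra. -/
instance instMeasurableSpaceL2Sphere : MeasurableSpace L2Sphere := borel L2Sphere

instance instBorelSpaceL2Sphere : BorelSpace L2Sphere := ⟨rfl⟩

/-- The geodesic distance `arccos ⟨x, y⟩` on `𝕊²`. -/
def geodesicDist (x y : Sphere2) : ℝ := Real.arccos (inner ℝ (x : E3) (y : E3))

/-- The space-time domain `M = [0, T] × 𝕊²`. -/
abbrev SpaceTime (T : ℝ) : Type := Set.Icc (0 : ℝ) T × Sphere2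

/-- The product metric `d_M((t, x), (s, y)) = |t - s| + d_{𝕊²}(x, y)`. -/
def distM {T : ℝ} (p q : SpaceTime T) : ℝ :=
  |(p.1 : ℝ) - (q.1 : ℝ)| + geodesicDist p.2 q.2

/-- The `i`-th coordinate function on `𝕊²`. -/
def coordFun (i : Fin 3) : C(Sphere2, ℝ) where
  toFun x := (x : E3) i
  continuous_toFun := by fun_prop

/-- The Laplacian `∑ᵢ ∂ᵢ²` on real polynomials in three variables. -/
def polyLaplacian : MvPolynomial (Fin 3) ℝ →ₗ[ℝ] MvPolynomial (Fin 3) ℝ :=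
  ∑ i : Fin 3, (MvPolynomial.pderiv i).toLinearMap ∘ₗ (MvPolynomial.pderiv i).toLinearMap

/-- The real spherical harmonics of degree `ℓ`: the restrictions to `𝕊²` of the homogeneous
harmonic polynomials of degree `ℓ` on `ℝ³`. -/
def sphericalHarmonics (ℓ : ℕ) : Submodule ℝ C(Sphere2, ℝ) :=
  (MvPolynomial.homogeneousSubmodule (Fin 3) ℝ ℓ ⊓ LinearMap.ker polyLaplacian).map
    (MvPolynomial.aeval coordFun : MvPolynomial (Fin 3) ℝ →ₐ[ℝ] C(Sphere2, ℝ)).toLinearMap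

/-- The orders `m = -ℓ, …, ℓ`. -/
abbrev Order (ℓ : ℕ) : Type := Finset.Icc (-(ℓ : ℤ)) (ℓ : ℤ)

/-- The class in `L²(𝕊²)` of a continuous function. -/
def toL2 (f : C(Sphere2, ℝ)) : L2Sphere := ContinuousMap.toLp 2 surfaceMeasure ℝ f

/-- `Y` is a system `(Y_{ℓ,m})` of real-valued orthonormal spherical harmonics:
`Y_{ℓ,-ℓ}, …, Y_{ℓ,ℓ}` span the spherical harmonics of degree `ℓ`, and the whole family is
orthonormal in `L²(𝕊²)`. -/
structure IsHarmonicBasis (Y : (ℓ : ℕ) → Order ℓ → C(Sphere2, ℝ)) : Prop where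
  span_eq : ∀ ℓ, Submodule.span ℝ (Set.range (Y ℓ)) = sphericalHarmonics ℓ
  orthonormal : Orthonormal ℝ (fun p : (ℓ : ℕ) × Order ℓ => toL2 (Y p.1 p.2))

/-- `Q` is the operator on `L²(𝕊²)` with angular power spectrum `A`, that is, with the
eigendecomposition `Q u = ∑_{ℓ,m} A_ℓ ⟨Y_{ℓ,m}, u⟩ Y_{ℓ,m}`. -/
def HasAngularPowerSpectrum (Y : (ℓ : ℕ) → Order ℓ → C(Sphere2, ℝ)) (A : ℕ → ℝ)
    (Q : L2Sphere →L[ℝ] L2Sphere) : Prop :=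
  ∀ u : L2Sphere, HasSum
    (fun p : (ℓ : ℕ) × Order ℓ => (A p.1 * inner ℝ (toL2 (Y p.1 p.2)) u) • toL2 (Y p.1 p.2))
    (Q u)

/-- The summability condition with parameter `η` on an angular power spectrum. -/
structure SummabilityCondition (A : ℕ → ℝ) (η : ℝ) : Prop where
  nonneg : ∀ ℓ, 0 ≤ A ℓ
  pos : 0 < η
  summable : Summable (fun ℓ : ℕ => A ℓ * (ℓ : ℝ) ^ (1 + η))

/-- The covariance function of real-valued fractional Brownian motion. -/
def fbmCov (H s t : ℝ) : ℝ := (1 / 2) * (t ^ (2 * H) + s ^ (2 * H) - |t - s| ^ (2 * H))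

/-- `B` is a (standard) isotropic `Q`-fractional Brownian motion on `[0, T]` with Hurst
parameter `H`: a continuous `L²(𝕊²)`-valued Gaussian process, centred and with covariance
`E[⟨B(t), u⟩ ⟨B(s), v⟩] = φ_H(t, s) ⟨Q u, v⟩`. -/
structure IsQfBm {Ω : Type*} [MeasurableSpace Ω] (P : Measure Ω) (T H : ℝ)
    (Q : L2Sphere →L[ℝ] L2Sphere) (B : Set.Icc (0 : ℝ) T → Ω → L2Sphere) : Prop where
  gaussian : IsGaussianProcess B P
  continuous : ∀ᵐ ω ∂P, Continuous (fun t => B t ω)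
  mean : ∀ (t : Set.Icc (0 : ℝ) T) (u : L2Sphere), ∫ ω, inner ℝ (B t ω) u ∂P = 0
  cov : ∀ (s t : Set.Icc (0 : ℝ) T) (u v : L2Sphere),
    ∫ ω, inner ℝ (B t ω) u * inner ℝ (B s ω) v ∂P = fbmCov H t s * inner ℝ (Q u) v

/-- The partial sum `∑_{ℓ < L} ∑_{m=-ℓ}^{ℓ} ⟨B(t), Y_{ℓ,m}⟩ Y_{ℓ,m}(x)` of the basis expansion of
`B` at the space-time point `p = (t, x)`. -/
def partialExpansion {Ω : Type*} {T : ℝ} (Y : (ℓ : ℕ) → Order ℓ → C(Sphere2, ℝ))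
    (B : Set.Icc (0 : ℝ) T → Ω → L2Sphere) (L : ℕ) (p : SpaceTime T) (ω : Ω) : ℝ :=
  ∑ ℓ ∈ Finset.range L, ∑ m : Order ℓ, inner ℝ (B p.1 ω) (toL2 (Y ℓ m)) * Y ℓ m p.2

/-- `X` is (a version of) the space-time random field of `B`: at every space-time point it is the
limit in `L²(Ω)` of the basis expansion of `B`. -/
def IsSpaceTimeField {Ω : Type*} [MeasurableSpace Ω] (P : Measure Ω) {T : ℝ}
    (Y : (ℓ : ℕ) → Order ℓ → C(Sphere2, ℝ)) (B : Set.Icc (0 : ℝ) T → Ω → L2Sphere)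
    (X : SpaceTime T → Ω → ℝ) : Prop :=
  ∀ p : SpaceTime T, MemLp (X p) 2 P ∧
    Tendsto (fun L : ℕ => eLpNorm (fun ω => partialExpansion Y B L p ω - X p ω) 2 P)
      atTop (𝓝 0)

/-- `Z` is a modification of `X`. -/
def IsModification {Ω ι : Type*} [MeasurableSpace Ω] (P : Measure Ω) (Z X : ι → Ω → ℝ) : Prop :=
  (∀ p, Measurable (Z p)) ∧ ∀ p, Z p =ᵐ[P] X p

/-- `f` is Hölder continuous on `M` of exponent `α` with respect to `d_M`. -/
def IsHolderM {T : ℝ} (α : ℝ) (f : SpaceTime T → ℝ) : Prop :=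
  ∃ C : ℝ, ∀ p q : SpaceTime T, |f p - f q| ≤ C * distM p q ^ α

end QfBm

end

/-! The field is Gaussian, so Hölder regularity reduces to a second-moment bound for increments: if
E|X(p) - X(q)|² ≤ C d(p,q)^{2γ} with γ = min(H, η/2), all moments scale accordingly and
Kolmogorov–Chentsov chaining with arbitrarily high moments reaches every exponent below γ.

An increment splits into a temporal and a spatial part. The temporal one has variance |t-s|^{2H}
times the pointwise variance, which by the addition theorem is at most the sum of A_ℓ(2ℓ+1)/|𝕊²|.
The spatial one has variance at most T^{2H} times the sum over ℓ of A_ℓ ∑_m (Y_{ℓ,m}(x) -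
Y_{ℓ,m}(y))². The inner sum is at most ℓ² d(x,y)² (2ℓ+1)/|𝕊²| (`IsHarmonicBasis.sum_sub_sq_le`) and,
trivially, at most 4(2ℓ+1)/|𝕊²|; interpolating gives (ℓ d(x,y))^{2γ}, and 2γ ≤ η makes the series
converge.

The Lipschitz bound needs no Legendre polynomials. Sums of squares over an orthonormal basis of
degree ℓ are invariant under orthogonal maps, so the increment can be slid along a great circle and
averaged over ℓ+1 equispaced points. There a harmonic is a trigonometric polynomial, and discrete
Parseval gives Bernstein's inequality.

Bounds are proved for the partial sums, uniformly in the truncation, and pass to the L² limit by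
Fatou. Completeness of the harmonics in L²(𝕊²) is never used: `Q` annihilates their orthogonal
complement, so B(t) almost surely lies in their closed span, which identifies Z(t,·) with B(t). -/

noncomputable section

namespace QfBm

open scoped Pointwise

/-! ### Orthogonal maps acting on the sphere and on harmonic polynomials -/

section

/-- The action of a linear isometry of `ℝ³` on the unit sphere. -/
def sphereIsometry (R : E3 ≃ₗᵢ[ℝ] E3) : C(Sphere2, Sphere2) where
  toFun x := ⟨R x, by simp⟩
  continuous_toFun := by fun_prop

@[simp]
lemma coe_sphereIsometry (R : E3 ≃ₗᵢ[ℝ] E3) (x : Sphere2) :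
    (sphereIsometry R x : E3) = R x := rfl

lemma sphereIsometry_symm_apply (R : E3 ≃ₗᵢ[ℝ] E3) (x : Sphere2) :
    sphereIsometry R.symm (sphereIsometry R x) = x := by
  ext1; simp

/-- Surface measure is, up to a constant, the volume of the cone over a set; a linear isometry
commutes with forming cones and preserves volume. -/
lemma measurePreserving_sphereIsometry (R : E3 ≃ₗᵢ[ℝ] E3) :
    MeasurePreserving (sphereIsometry R) surfaceMeasure surfaceMeasure := by
  refine ⟨(sphereIsometry R).continuous.measurable, ?_⟩
  ext s hs
  rw [Measure.map_apply (sphereIsometry R).continuous.measurable hs,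
    Measure.toSphere_apply' _ ((sphereIsometry R).continuous.measurable hs),
    Measure.toSphere_apply' _ hs]
  congr 1
  have hset : R ⁻¹' (Set.Ioo (0 : ℝ) 1 • ((↑) '' s : Set E3)) =
      Set.Ioo (0 : ℝ) 1 • ((↑) '' (sphereIsometry R ⁻¹' s) : Set E3) := by
    ext v
    simp only [Set.mem_preimage, Set.mem_smul, Set.mem_image, Subtype.exists, exists_and_right,
      exists_eq_right]
    constructor
    · rintro ⟨r, hr, y, ⟨hy, hys⟩, h⟩
      refine ⟨r, hr, R.symm y, ⟨by simpa using hy, ?_⟩, ?_⟩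
      · convert! hys
        ext1; simp
      · apply R.injective; simp [h]
    · rintro ⟨r, hr, y, ⟨hy, hys⟩, h⟩
      exact ⟨r, hr, R y, ⟨by simpa using hy, hys⟩, by rw [← h]; simp⟩
  rw [← hset]
  exact R.measurePreserving.measure_preimage_emb R.toHomeomorph.measurableEmbedding _

/-- The linear substitution of variables with matrix `a`. -/
def linSubst (a : Matrix (Fin 3) (Fin 3) ℝ) :
    MvPolynomial (Fin 3) ℝ →ₐ[ℝ] MvPolynomial (Fin 3) ℝ :=
  MvPolynomial.aeval fun i => ∑ j, MvPolynomial.C (a i j) * MvPolynomial.X j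

/-- Chain rule for a linear substitution. -/
lemma pderiv_linSubst (a : Matrix (Fin 3) (Fin 3) ℝ) (k : Fin 3) (p : MvPolynomial (Fin 3) ℝ) :
    MvPolynomial.pderiv k (linSubst a p) =
      ∑ i, MvPolynomial.C (a i k) * linSubst a (MvPolynomial.pderiv i p) := by
  induction p using MvPolynomial.induction_on with
  | C c => simp [linSubst]
  | add p q hp hq => simp only [map_add, hp, hq, mul_add, Finset.sum_add_distrib]
  | mul_X p n hp =>
    have hX : MvPolynomial.pderiv k (linSubst a (MvPolynomial.X n)) = MvPolynomial.C (a n k) := by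
      simp [linSubst, MvPolynomial.pderiv_X, Pi.single_apply]
    simp only [map_mul, Derivation.leibniz, hp, hX, smul_eq_mul, map_add, mul_add, Finset.sum_add_distrib, Finset.mul_sum]
    congr 1
    · rw [Finset.sum_eq_single n]
      · simp [mul_comm]
      · intro i _ hi
        simp [MvPolynomial.pderiv_X_of_ne hi.symm]
      · simp
    · exact Finset.sum_congr rfl fun i _ => by ring

/-- Two applications of the chain rule contract the Hessian with `a * aᵀ`, which orthogonality turns
into the identity. -/
lemma polyLaplacian_linSubst {a : Matrix (Fin 3) (Fin 3) ℝ} (ha : a * a.transpose = 1)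
    (p : MvPolynomial (Fin 3) ℝ) :
    polyLaplacian (linSubst a p) = linSubst a (polyLaplacian p) := by
  have key : ∀ i j, ∑ k, MvPolynomial.C (σ := Fin 3) (a i k) * MvPolynomial.C (a j k) =
      if i = j then 1 else 0 := by
    intro i j
    simp only [← map_mul, ← map_sum]
    have := congrFun (congrFun ha i) j
    rw [Matrix.mul_apply] at this
    simp only [Matrix.transpose_apply] at this
    rw [this, Matrix.one_apply]
    split_ifs <;> simp
  simp only [polyLaplacian, LinearMap.sum_apply, LinearMap.comp_apply, Derivation.coeFn_coe,
    map_sum, pderiv_linSubst, MvPolynomial.pderiv_C_mul]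
  calc _ = ∑ i, ∑ j, (∑ k, MvPolynomial.C (σ := Fin 3) (a i k) * MvPolynomial.C (a j k)) *
        linSubst a (MvPolynomial.pderiv j (MvPolynomial.pderiv i p)) := by
        rw [Finset.sum_comm]
        refine Finset.sum_congr rfl fun i _ => ?_
        simp only [Finset.mul_sum, Finset.sum_mul]
        rw [Finset.sum_comm]
        exact Finset.sum_congr rfl fun i _ => Finset.sum_congr rfl fun i _ => by ring
    _ = _ := by simp [key]

lemma isHomogeneous_linSubst (a : Matrix (Fin 3) (Fin 3) ℝ) {p : MvPolynomial (Fin 3) ℝ} {ℓ : ℕ}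
    (hp : p.IsHomogeneous ℓ) : (linSubst a p).IsHomogeneous ℓ := by
  have := hp.aeval (n := 1) (fun i => ∑ j, MvPolynomial.C (a i j) * MvPolynomial.X j) fun i =>
    MvPolynomial.IsHomogeneous.sum _ _ _ fun j _ => by
      simpa using (MvPolynomial.isHomogeneous_C (Fin 3) (a i j)).mul
        (MvPolynomial.isHomogeneous_X ℝ j)
  simpa [linSubst] using this

/-- The matrix of a linear isometry of `ℝ³`. -/
def isometryMatrix (R : E3 ≃ₗᵢ[ℝ] E3) : Matrix (Fin 3) (Fin 3) ℝ :=
  fun i j => R (EuclideanSpace.single j 1) i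

lemma isometryMatrix_apply (R : E3 ≃ₗᵢ[ℝ] E3) (v : E3) (i : Fin 3) :
    R v i = ∑ j, isometryMatrix R i j * v j := by
  have hv : v = ∑ j, v j • EuclideanSpace.single j (1 : ℝ) := by
    ext k
    simp [Pi.single_apply]
  conv_lhs => rw [hv]
  simp [isometryMatrix, mul_comm]

lemma isometryMatrix_mul_transpose (R : E3 ≃ₗᵢ[ℝ] E3) :
    isometryMatrix R * (isometryMatrix R).transpose = 1 := by
  -- Preservation of inner products says that the columns are orthonormal; the Laplacian needs the
  -- rows, hence the swap.
  apply mul_eq_one_comm.mp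
  ext i j
  have h := R.inner_map_map (EuclideanSpace.single i (1 : ℝ)) (EuclideanSpace.single j (1 : ℝ))
  rw [PiLp.inner_apply] at h
  simp only [RCLike.inner_apply, conj_trivial] at h
  rw [Matrix.mul_apply, Matrix.one_apply]
  simp only [Matrix.transpose_apply, isometryMatrix]
  rw [← Finset.sum_congr rfl fun k _ => mul_comm _ _, h]
  simp [EuclideanSpace.inner_single_left]

lemma aeval_coordFun_apply (p : MvPolynomial (Fin 3) ℝ) (x : Sphere2) :
    (MvPolynomial.aeval coordFun p : C(Sphere2, ℝ)) x = MvPolynomial.eval (fun i => (x : E3) i) p := by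
  induction p using MvPolynomial.induction_on with
  | C c => simp
  | add p q hp hq => simp [hp, hq]
  | mul_X p n hp => simp [hp, coordFun]

lemma comp_sphereIsometry_mem_sphericalHarmonics (R : E3 ≃ₗᵢ[ℝ] E3) {ℓ : ℕ} {f : C(Sphere2, ℝ)}
    (hf : f ∈ sphericalHarmonics ℓ) : f.comp (sphereIsometry R) ∈ sphericalHarmonics ℓ := by
  obtain ⟨p, ⟨hp1, hp2⟩, rfl⟩ := hf
  refine ⟨linSubst (isometryMatrix R) p, ⟨isHomogeneous_linSubst _ hp1, ?_⟩, ?_⟩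
  · have hp2' : polyLaplacian p = 0 := hp2
    show polyLaplacian _ = 0
    rw [polyLaplacian_linSubst (isometryMatrix_mul_transpose R), hp2', map_zero]
  · ext x
    simp only [AlgHom.toLinearMap_apply, ContinuousMap.comp_apply, aeval_coordFun_apply,
      coe_sphereIsometry]
    rw [linSubst, ← MvPolynomial.coe_aeval_eq_eval, ← MvPolynomial.coe_aeval_eq_eval]
    simp only [RingHom.coe_coe]
    rw [← AlgHom.comp_apply, MvPolynomial.comp_aeval]
    congr 2
    funext i
    simp [isometryMatrix_apply]

end

/-! ### Invariant sums of squares and the addition theorem -/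

section

lemma toL2_add (f g : C(Sphere2, ℝ)) : toL2 (f + g) = toL2 f + toL2 g := map_add _ f g

lemma toL2_smul (c : ℝ) (f : C(Sphere2, ℝ)) : toL2 (c • f) = c • toL2 f := map_smul _ c f

lemma toL2_sub (f g : C(Sphere2, ℝ)) : toL2 (f - g) = toL2 f - toL2 g := map_sub _ f g

lemma toL2_zero : toL2 0 = 0 := map_zero (ContinuousMap.toLp 2 surfaceMeasure ℝ)

lemma inner_toL2 (f g : C(Sphere2, ℝ)) :
    inner ℝ (toL2 f) (toL2 g) = ∫ x, f x * g x ∂surfaceMeasure := by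
  rw [toL2, toL2, ContinuousMap.inner_toLp]
  simp [mul_comm]

lemma inner_toL2_comp (R : E3 ≃ₗᵢ[ℝ] E3) (f g : C(Sphere2, ℝ)) :
    inner ℝ (toL2 (f.comp (sphereIsometry R))) (toL2 (g.comp (sphereIsometry R))) =
      inner ℝ (toL2 f) (toL2 g) := by
  rw [inner_toL2, inner_toL2]
  have hR := measurePreserving_sphereIsometry R
  conv_rhs => rw [← hR.map_eq]
  rw [integral_map hR.measurable.aemeasurable]
  · rfl
  · exact (f * g).continuous.aestronglyMeasurable

section Functional

variable {ι : Type*} [Fintype ι]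

/-- The Riesz representer of `L` on the span, written in the orthonormal basis `f`. -/
lemma inner_sum_smul_of_mem_span {f : ι → C(Sphere2, ℝ)} (hf : Orthonormal ℝ (toL2 ∘ f))
    (L : C(Sphere2, ℝ) →ₗ[ℝ] ℝ) {g : C(Sphere2, ℝ)} (hg : g ∈ Submodule.span ℝ (Set.range f)) :
    inner ℝ (∑ i, L (f i) • toL2 (f i)) (toL2 g) = L g := by
  induction hg using Submodule.span_induction with
  | mem g hg =>
    obtain ⟨j, rfl⟩ := hg
    simpa using hf.inner_left_fintype (fun i => L (f i)) j
  | zero => simp [toL2_zero]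
  | add g₁ g₂ _ _ h₁ h₂ => rw [toL2_add, inner_add_right, h₁, h₂, map_add]
  | smul c g _ h => rw [toL2_smul, inner_smul_right, h, map_smul, smul_eq_mul]

/-- The sum of squares of a functional over an orthonormal basis does not depend on the basis. -/
lemma sum_sq_eq_of_orthonormal {f g : ι → C(Sphere2, ℝ)} (hf : Orthonormal ℝ (toL2 ∘ f))
    (hg : Orthonormal ℝ (toL2 ∘ g)) (hgf : ∀ i, g i ∈ Submodule.span ℝ (Set.range f))
    (hfg : ∀ i, f i ∈ Submodule.span ℝ (Set.range g)) (L : C(Sphere2, ℝ) →ₗ[ℝ] ℝ) :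
    ∑ i, L (f i) ^ 2 = ∑ i, L (g i) ^ 2 := by
  -- Both bases produce a representer of `L`; pairing the two and reading the result in either basis
  -- gives both sums of squares.
  have h₁ : inner ℝ (∑ i, L (f i) • toL2 (f i)) (∑ i, L (g i) • toL2 (g i)) =
      ∑ i, L (g i) ^ 2 := by
    rw [inner_sum]
    refine Finset.sum_congr rfl fun i _ => ?_
    rw [inner_smul_right, inner_sum_smul_of_mem_span hf L (hgf i), sq]
  have h₂ : inner ℝ (∑ i, L (g i) • toL2 (g i)) (∑ i, L (f i) • toL2 (f i)) =
      ∑ i, L (f i) ^ 2 := by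
    rw [inner_sum]
    refine Finset.sum_congr rfl fun i _ => ?_
    rw [inner_smul_right, inner_sum_smul_of_mem_span hg L (hfg i), sq]
  rw [← h₁, ← h₂, real_inner_comm]

end Functional

/-- Precomposition with an isometry of the sphere, as a linear map. -/
def compIsometry (R : E3 ≃ₗᵢ[ℝ] E3) : C(Sphere2, ℝ) →ₗ[ℝ] C(Sphere2, ℝ) where
  toFun f := f.comp (sphereIsometry R)
  map_add' _ _ := rfl
  map_smul' _ _ := rfl

lemma compIsometry_symm (R : E3 ≃ₗᵢ[ℝ] E3) (f : C(Sphere2, ℝ)) :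
    compIsometry R (compIsometry R.symm f) = f := by
  ext x
  simp only [compIsometry, LinearMap.coe_mk, AddHom.coe_mk, ContinuousMap.comp_apply,
    sphereIsometry_symm_apply]

lemma surfaceMeasure_real_univ_pos : 0 < surfaceMeasure.real Set.univ := by
  simp only [Measure.real]
  refine ENNReal.toReal_pos ?_ (measure_ne_top _ _)
  simp only [ne_eq, Measure.measure_univ_eq_zero]
  exact Measure.toSphere_ne_zero _

variable {Y : (ℓ : ℕ) → Order ℓ → C(Sphere2, ℝ)}

namespace IsHarmonicBasis

lemma orthonormal_degree (hY : IsHarmonicBasis Y) (ℓ : ℕ) : Orthonormal ℝ (toL2 ∘ Y ℓ) :=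
  hY.orthonormal.comp (fun m => ⟨ℓ, m⟩) fun _ _ h => by simpa using h

lemma mem_sphericalHarmonics (hY : IsHarmonicBasis Y) {ℓ : ℕ} (m : Order ℓ) :
    Y ℓ m ∈ sphericalHarmonics ℓ := by
  rw [← hY.span_eq]; exact Submodule.subset_span ⟨m, rfl⟩

/-- Rotating the harmonics of degree ℓ yields another orthonormal basis of the same space, and the
sum of squares is basis-free. -/
lemma sum_sq_comp_isometry (hY : IsHarmonicBasis Y) (ℓ : ℕ) (R : E3 ≃ₗᵢ[ℝ] E3)
    (L : C(Sphere2, ℝ) →ₗ[ℝ] ℝ) :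
    ∑ m, L ((Y ℓ m).comp (sphereIsometry R)) ^ 2 = ∑ m, L (Y ℓ m) ^ 2 := by
  refine (sum_sq_eq_of_orthonormal (hY.orthonormal_degree ℓ)
    (g := fun m => (Y ℓ m).comp (sphereIsometry R)) ?_ ?_ ?_ L).symm
  · have := hY.orthonormal_degree ℓ
    rw [orthonormal_iff_ite] at this ⊢
    intro i j
    rw [← this i j]
    exact inner_toL2_comp R _ _
  · intro m
    rw [hY.span_eq]
    exact comp_sphereIsometry_mem_sphericalHarmonics R (hY.mem_sphericalHarmonics m)
  · intro m
    have h : compIsometry R.symm (Y ℓ m) ∈ Submodule.span ℝ (Set.range (Y ℓ)) := by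
      rw [hY.span_eq]
      exact comp_sphereIsometry_mem_sphericalHarmonics R.symm (hY.mem_sphericalHarmonics m)
    have h2 := Submodule.mem_map_of_mem (f := compIsometry R) h
    rw [compIsometry_symm, Submodule.map_span, ← Set.range_comp] at h2
    exact h2

lemma sum_sq_isometry_apply (hY : IsHarmonicBasis Y) (ℓ : ℕ) (R : E3 ≃ₗᵢ[ℝ] E3) (x : Sphere2) :
    ∑ m, Y ℓ m (sphereIsometry R x) ^ 2 = ∑ m, Y ℓ m x ^ 2 :=
  hY.sum_sq_comp_isometry ℓ R
    { toFun := fun f => f x, map_add' := fun _ _ => rfl, map_smul' := fun _ _ => rfl }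

lemma sum_sub_sq_isometry_apply (hY : IsHarmonicBasis Y) (ℓ : ℕ) (R : E3 ≃ₗᵢ[ℝ] E3)
    (x y : Sphere2) :
    ∑ m, (Y ℓ m (sphereIsometry R x) - Y ℓ m (sphereIsometry R y)) ^ 2 =
      ∑ m, (Y ℓ m x - Y ℓ m y) ^ 2 :=
  hY.sum_sq_comp_isometry ℓ R
    { toFun := fun f => f x - f y
      map_add' := fun f g => by simp; ring
      map_smul' := fun c f => by simp; ring }

/-- Orthogonal maps act transitively: the reflection in the hyperplane orthogonal to `y - x` carries
`y` to `x`. -/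
lemma sum_sq_apply_eq (hY : IsHarmonicBasis Y) (ℓ : ℕ) (x y : Sphere2) :
    ∑ m, Y ℓ m x ^ 2 = ∑ m, Y ℓ m y ^ 2 := by
  have h : ‖(y : E3)‖ = ‖(x : E3)‖ := by simp
  have hR : sphereIsometry (Submodule.reflection (Submodule.span ℝ {(y : E3) - x})ᗮ) y = x :=
    Subtype.ext (Submodule.reflection_sub h)
  rw [← hY.sum_sq_isometry_apply ℓ _ y, hR]

/-- The addition theorem on the diagonal. -/
lemma sum_sq_apply (hY : IsHarmonicBasis Y) (ℓ : ℕ) (x : Sphere2) :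
    ∑ m, Y ℓ m x ^ 2 = (2 * ℓ + 1) / surfaceMeasure.real Set.univ := by
  rw [eq_div_iff surfaceMeasure_real_univ_pos.ne']
  -- The sum is constant on the sphere, so its value is its integral divided by the area; the
  -- integral counts the 2ℓ+1 normalised functions.
  have h₁ : ∫ y, ∑ m, Y ℓ m y ^ 2 ∂surfaceMeasure = 2 * ℓ + 1 := by
    rw [integral_finsetSum]
    · have : ∀ m, ∫ y, Y ℓ m y ^ 2 ∂surfaceMeasure = 1 := fun m => by
        have h := (hY.orthonormal_degree ℓ).1 m
        have h2 := inner_toL2 (Y ℓ m) (Y ℓ m)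
        rw [real_inner_self_eq_norm_sq] at h2
        simp only [Function.comp_apply] at h
        simpa [h, sq] using h2.symm
      have hcard : ((ℓ : ℤ) + 1 - -(ℓ : ℤ)).toNat = 2 * ℓ + 1 := by omega
      simp only [this, Finset.sum_const, nsmul_eq_mul, mul_one, Finset.card_univ,
        Fintype.card_coe, Int.card_Icc, hcard]
      push_cast
      ring
    · intro m _
      have h : Continuous fun y => Y ℓ m y ^ 2 := by fun_prop
      exact h.integrable_of_hasCompactSupport (HasCompactSupport.of_compactSpace _)
  have h₂ : ∫ y, ∑ m, Y ℓ m y ^ 2 ∂surfaceMeasure = ∫ _, ∑ m, Y ℓ m x ^ 2 ∂surfaceMeasure :=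
    integral_congr_ae (.of_forall fun y => hY.sum_sq_apply_eq ℓ y x)
  rw [← h₁, h₂, integral_const, smul_eq_mul, mul_comm]

end IsHarmonicBasis

end

/-! ### Great circles and a Bernstein inequality for spherical harmonics -/

section

section GreatCircle

variable {v w : E3} (hv : ‖v‖ = 1) (hw : ‖w‖ = 1) (hvw : inner ℝ v w = 0)

/-- The great circle through the orthonormal vectors `v` and `w`. -/
def greatCircle (θ : ℝ) : Sphere2 :=
  ⟨Real.cos θ • v + Real.sin θ • w, by
    rw [mem_sphere_zero_iff_norm, ← sq_eq_sq₀ (norm_nonneg _) zero_le_one, norm_add_sq_real]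
    simp only [norm_smul, hv, hw, inner_smul_left, inner_smul_right, hvw, Real.norm_eq_abs]
    simp⟩

/-- The vector `u` is the unit tangent of the circle at angle `a`; reflecting along it fixes the
point at `a` and reverses the circle about it. -/
lemma exists_isometry_greatCircle (a : ℝ) : ∃ R : E3 ≃ₗᵢ[ℝ] E3, ∀ φ,
    sphereIsometry R (greatCircle hv hw hvw φ) = greatCircle hv hw hvw (2 * a - φ) := by
  set u : E3 := Real.cos a • w - Real.sin a • v with hu
  have hwv : inner ℝ w v = 0 := by rw [real_inner_comm]; exact hvw
  have hun : ‖u‖ = 1 := by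
    rw [← sq_eq_sq₀ (norm_nonneg _) zero_le_one, hu, norm_sub_sq_real]
    simp only [norm_smul, hv, hw, inner_smul_left, inner_smul_right, hwv, Real.norm_eq_abs]
    simp
  refine ⟨Submodule.reflection (Submodule.span ℝ {u})ᗮ, fun φ => Subtype.ext ?_⟩
  rw [coe_sphereIsometry, Submodule.reflection_orthogonal_apply,
    Submodule.reflection_singleton_apply, hun]
  have h : inner ℝ u (greatCircle hv hw hvw φ : E3) = Real.sin (φ - a) := by
    simp only [hu, greatCircle, inner_add_right, inner_sub_left, inner_smul_left,
      inner_smul_right, hvw, hwv, real_inner_self_eq_norm_sq, hv, hw, Real.sin_sub]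
    simp; ring
  rw [h]
  have h1 : Real.cos (2 * a - φ) = Real.cos φ + 2 * Real.sin (φ - a) * Real.sin a := by
    have e1 : 2 * a - φ = a - (φ - a) := by ring
    have e2 : Real.cos φ = Real.cos ((φ - a) + a) := by ring_nf
    rw [e1, e2, Real.cos_sub, Real.cos_add]; ring
  have h2 : Real.sin (2 * a - φ) = Real.sin φ - 2 * Real.sin (φ - a) * Real.cos a := by
    have e1 : 2 * a - φ = a - (φ - a) := by ring
    have e2 : Real.sin φ = Real.sin ((φ - a) + a) := by ring_nf
    rw [e1, e2, Real.sin_sub, Real.sin_add]; ring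
  simp only [greatCircle, h1, h2, hu]
  simp only [RCLike.ofReal_real_eq_id, id, one_pow, div_one]
  module

end GreatCircle

lemma exists_orthonormal_greatCircle (x y : Sphere2) :
    ∃ (v w : E3) (hv : ‖v‖ = 1) (hw : ‖w‖ = 1) (hvw : inner ℝ v w = 0),
      greatCircle hv hw hvw 0 = x ∧ greatCircle hv hw hvw (geodesicDist x y) = y := by
  have hx : ‖(x : E3)‖ = 1 := by simp
  have hy : ‖(y : E3)‖ = 1 := by simp
  set c : ℝ := inner ℝ (x : E3) (y : E3) with hc
  have hcos : Real.cos (geodesicDist x y) = c := by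
    have h := abs_real_inner_le_norm (x : E3) (y : E3)
    rw [hx, hy, one_mul, abs_le] at h
    exact Real.cos_arccos h.1 h.2
  have hsin : Real.sin (geodesicDist x y) = √(1 - c ^ 2) := Real.sin_arccos _
  set z : E3 := y - c • x with hz
  have hxz : inner ℝ (x : E3) z = 0 := by
    rw [hz, inner_sub_right, inner_smul_right, real_inner_self_eq_norm_sq, hx, ← hc]; ring
  have hzn : ‖z‖ = √(1 - c ^ 2) := by
    have h : ‖z‖ ^ 2 = 1 - c ^ 2 := by
      rw [hz, norm_sub_sq_real, inner_smul_right, real_inner_comm, ← hc, norm_smul, hx, hy,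
        Real.norm_eq_abs, mul_one, sq_abs]
      ring
    rw [← h, Real.sqrt_sq (norm_nonneg _)]
  -- Here `y = ±x`, the sine of the distance vanishes, and any unit vector orthogonal to `x` may
  -- serve as `w`.
  by_cases h0 : z = 0
  · obtain ⟨w, hw, hxw⟩ : ∃ w : E3, ‖w‖ = 1 ∧ inner ℝ (x : E3) w = 0 := by
      have : Fact (Module.finrank ℝ E3 = 2 + 1) := ⟨by simp⟩
      have hx0 : (x : E3) ≠ 0 := by intro h; simp [h] at hx
      have hfr := Submodule.finrank_orthogonal_span_singleton (𝕜 := ℝ) (n := 2) hx0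
      have : Nontrivial (Submodule.span ℝ {(x : E3)})ᗮ :=
        Module.nontrivial_of_finrank_pos (R := ℝ) (by rw [hfr]; norm_num)
      obtain ⟨w, hw⟩ := exists_ne (0 : (Submodule.span ℝ {(x : E3)})ᗮ)
      have hw' : (w : E3) ≠ 0 := by simpa using hw
      refine ⟨‖(w : E3)‖⁻¹ • (w : E3), ?_, ?_⟩
      · rw [norm_smul, norm_inv, norm_norm, inv_mul_cancel₀ (norm_ne_zero_iff.mpr hw')]
      · rw [inner_smul_right, Submodule.mem_orthogonal_singleton_iff_inner_right.mp w.2, mul_zero]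
    refine ⟨x, w, hx, hw, hxw, Subtype.ext (by simp [greatCircle]), Subtype.ext ?_⟩
    rw [h0, norm_zero] at hzn
    simp only [greatCircle, hcos, hsin, ← hzn, zero_smul, add_zero]
    exact (sub_eq_zero.mp h0).symm
  · have hz0 : ‖z‖ ≠ 0 := norm_ne_zero_iff.mpr h0
    refine ⟨x, ‖z‖⁻¹ • z, hx, by rw [norm_smul, norm_inv, norm_norm, inv_mul_cancel₀ hz0],
      by rw [inner_smul_right, hxz, mul_zero], Subtype.ext (by simp [greatCircle]),
      Subtype.ext ?_⟩
    have h : ‖z‖ • ‖z‖⁻¹ • z = y - c • (x : E3) := by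
      rw [smul_smul, mul_inv_cancel₀ hz0, one_smul, hz]
    simp only [greatCircle, hcos, hsin, ← hzn, h]
    abel

lemma eval_mul_of_isHomogeneous {σ R : Type*} [CommSemiring R] {p : MvPolynomial σ R} {n : ℕ}
    (hp : p.IsHomogeneous n) (c : R) (y : σ → R) :
    MvPolynomial.eval (fun i => c * y i) p = c ^ n * MvPolynomial.eval y p := by
  rw [MvPolynomial.eval_eq, MvPolynomial.eval_eq, Finset.mul_sum]
  refine Finset.sum_congr rfl fun d hd => ?_
  simp only [mul_pow, Finset.prod_mul_distrib, Finset.prod_pow_eq_pow_sum]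
  have : ∑ i ∈ d.support, d i = n := by
    have := hp (MvPolynomial.mem_support_iff.mp hd)
    rwa [Finsupp.weight_apply, Finsupp.sum, Finset.sum_congr rfl fun i _ => by simp; rfl] at this
  rw [this]; ring

/-- On a great circle a spherical harmonic of degree `ℓ` is a trigonometric polynomial of
degree `ℓ`. -/
lemma exists_polynomial_greatCircle {v w : E3} (hv : ‖v‖ = 1) (hw : ‖w‖ = 1)
    (hvw : inner ℝ v w = 0) {ℓ : ℕ} {f : C(Sphere2, ℝ)} (hf : f ∈ sphericalHarmonics ℓ) :
    ∃ q : Polynomial ℂ, q.natDegree ≤ ℓ ∧ ∀ θ : ℝ, (f (greatCircle hv hw hvw θ) : ℂ) =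
      Complex.exp (-(ℓ * θ * Complex.I)) * q.eval (Complex.exp (2 * θ * Complex.I)) := by
  obtain ⟨p, ⟨hp, -⟩, rfl⟩ := hf
  set pC : MvPolynomial (Fin 3) ℂ := MvPolynomial.map (algebraMap ℝ ℂ) p
  have hpC : pC.IsHomogeneous ℓ := MvPolynomial.IsHomogeneous.map hp _
  -- Chosen so that e^{-iθ} b(e^{2iθ}) = cos θ v + sin θ w; homogeneity then pulls out the factor
  -- e^{-iℓθ}.
  let b : Fin 3 → Polynomial ℂ := fun i =>
    Polynomial.C ((v i - Complex.I * w i) / 2) * Polynomial.X +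
      Polynomial.C ((v i + Complex.I * w i) / 2)
  refine ⟨MvPolynomial.aeval b pC, ?_, fun θ => ?_⟩
  · have := MvPolynomial.aeval_natDegree_le pC hpC.totalDegree_le b (n := 1)
      fun i => Polynomial.natDegree_linear_le
    simpa using this
  · have h1 : (MvPolynomial.aeval b pC).eval (Complex.exp (2 * θ * Complex.I)) =
        MvPolynomial.eval (fun i => (b i).eval (Complex.exp (2 * θ * Complex.I))) pC := by
      rw [← MvPolynomial.coe_aeval_eq_eval, ← Polynomial.coe_aeval_eq_eval]
      simp only [RingHom.coe_coe]
      rw [← AlgHom.comp_apply, MvPolynomial.comp_aeval]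
    have h2 : Complex.exp (-(ℓ * θ * Complex.I)) = Complex.exp (-(θ * Complex.I)) ^ ℓ := by
      rw [← Complex.exp_nat_mul]; congr 1; ring
    rw [h1, h2, ← eval_mul_of_isHomogeneous hpC]
    simp only [AlgHom.toLinearMap_apply, aeval_coordFun_apply]
    have h3 : ∀ x : Fin 3 → ℝ, ((MvPolynomial.eval x p : ℝ) : ℂ) =
        MvPolynomial.eval (fun i => (x i : ℂ)) pC := fun x => by
      rw [MvPolynomial.eval_map]
      exact MvPolynomial.eval₂_comp_left Complex.ofRealHom _ _ _
    rw [h3]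
    congr 2
    funext i
    have hz : Complex.exp (-(θ * Complex.I)) * Complex.exp (2 * θ * Complex.I) =
        Complex.exp (θ * Complex.I) := by
      rw [← Complex.exp_add]; congr 1; ring
    have hc := Complex.two_cos (θ : ℂ)
    have hs := Complex.two_sin (θ : ℂ)
    have e : ((greatCircle hv hw hvw θ : E3) i : ℂ) =
        Complex.cos θ * v i + Complex.sin θ * w i := by
      simp [greatCircle]
    rw [e]
    simp only [b, Polynomial.eval_add, Polynomial.eval_mul, Polynomial.eval_C, Polynomial.eval_X]
    rw [mul_add, mul_left_comm, hz, Complex.cos, Complex.sin]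
    ring_nf

/-- Parseval's identity for the discrete Fourier transform. -/
lemma sum_norm_sq_sum_pow {N : ℕ} {ζ : ℂ} (hζ : IsPrimitiveRoot ζ N) (a : ℕ → ℂ) :
    ∑ k ∈ Finset.range N, ‖∑ j ∈ Finset.range N, a j * (ζ ^ k) ^ j‖ ^ 2 =
      N * ∑ j ∈ Finset.range N, ‖a j‖ ^ 2 := by
  rcases Nat.eq_zero_or_pos N with rfl | hN
  · simp
  have hnorm : ‖ζ‖ = 1 := hζ.norm'_eq_one hN.ne'
  have horth : ∀ i ∈ Finset.range N, ∀ j ∈ Finset.range N,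
      ∑ k ∈ Finset.range N, (ζ ^ k) ^ i * (starRingEnd ℂ) ((ζ ^ k) ^ j) =
        if i = j then (N : ℂ) else 0 := by
    intro i hi j hj
    have hconj : (starRingEnd ℂ) ζ = ζ⁻¹ := (Complex.inv_eq_conj hnorm).symm
    have hζ0 : ζ ≠ 0 := hζ.ne_zero hN.ne'
    have hterm : ∀ k, (ζ ^ k) ^ i * (starRingEnd ℂ) ((ζ ^ k) ^ j) = (ζ ^ i * (ζ ^ j)⁻¹) ^ k := by
      intro k
      rw [map_pow, map_pow, hconj, mul_pow, ← pow_mul, ← pow_mul, ← pow_mul, mul_comm k i,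
        mul_comm k j, inv_pow, inv_pow, ← pow_mul]
    simp only [hterm]
    split_ifs with hij
    · subst hij
      simp [mul_inv_cancel₀ (pow_ne_zero i hζ0)]
    · have hne : ζ ^ i * (ζ ^ j)⁻¹ ≠ 1 := by
        intro h
        rw [mul_inv_eq_one₀ (pow_ne_zero j hζ0)] at h
        exact hij (hζ.pow_inj (Finset.mem_range.mp hi) (Finset.mem_range.mp hj) h)
      have hpow : (ζ ^ i * (ζ ^ j)⁻¹) ^ N = 1 := by
        rw [mul_pow, inv_pow, ← pow_mul, ← pow_mul, mul_comm i, mul_comm j, pow_mul, pow_mul,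
          hζ.pow_eq_one]
        simp
      rw [geom_sum_eq hne, hpow, sub_self, zero_div]
  have hC : (∑ k ∈ Finset.range N, ‖∑ j ∈ Finset.range N, a j * (ζ ^ k) ^ j‖ ^ 2 : ℂ) =
      N * ∑ j ∈ Finset.range N, (‖a j‖ : ℂ) ^ 2 := by
    simp only [← Complex.mul_conj', map_sum, map_mul, Finset.sum_mul_sum]
    rw [Finset.sum_comm, Finset.mul_sum]
    refine Finset.sum_congr rfl fun i hi => ?_
    rw [Finset.sum_comm, Finset.sum_eq_single i]
    · have h := horth i hi i hi
      rw [if_pos rfl] at h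
      rw [← h, Finset.sum_mul]
      exact Finset.sum_congr rfl fun k _ => by ring
    · intro j hj hij
      have h := horth i hi j hj
      rw [if_neg hij.symm] at h
      rw [← mul_zero (a i * (starRingEnd ℂ) (a j)), ← h, Finset.mul_sum]
      exact Finset.sum_congr rfl fun k _ => by ring
    · exact fun h => absurd hi h
  exact_mod_cast hC

/-- A discrete `L²` Bernstein inequality for the restriction to a great circle of a spherical
harmonic. -/
lemma sum_sub_sq_greatCircle_le {v w : E3} (hv : ‖v‖ = 1) (hw : ‖w‖ = 1)
    (hvw : inner ℝ v w = 0) {ℓ : ℕ} {f : C(Sphere2, ℝ)} (hf : f ∈ sphericalHarmonics ℓ) (h : ℝ) :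
    ∑ k ∈ Finset.range (ℓ + 1), (f (greatCircle hv hw hvw (Real.pi * k / (ℓ + 1) + h)) -
        f (greatCircle hv hw hvw (Real.pi * k / (ℓ + 1)))) ^ 2 ≤
      ℓ ^ 2 * h ^ 2 * ∑ k ∈ Finset.range (ℓ + 1),
        f (greatCircle hv hw hvw (Real.pi * k / (ℓ + 1))) ^ 2 := by
  obtain ⟨q, hq, hfq⟩ := exists_polynomial_greatCircle hv hw hvw hf
  set ζ : ℂ := Complex.exp (2 * Real.pi * Complex.I / ((ℓ + 1 : ℕ) : ℂ)) with hζdef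
  have hζ : IsPrimitiveRoot ζ (ℓ + 1) := Complex.isPrimitiveRoot_exp _ (Nat.succ_ne_zero _)
  have hl0 : (ℓ + 1 : ℂ) ≠ 0 := by exact_mod_cast Nat.succ_ne_zero ℓ
  -- At the angles πk/(ℓ+1) the variable e^{2iθ} runs through the (ℓ+1)-th roots of unity, exactly
  -- enough for Parseval with the ℓ+1 coefficients of `q`.
  have hz : ∀ k : ℕ, Complex.exp (2 * ((Real.pi * k / (ℓ + 1) : ℝ) : ℂ) * Complex.I) = ζ ^ k := by
    intro k
    rw [hζdef, ← Complex.exp_nat_mul]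
    congr 1
    push_cast
    field_simp
  have hnorm : ∀ θ : ℝ, ‖Complex.exp (-(ℓ * θ * Complex.I))‖ = 1 := fun θ => by
    have : (-(ℓ * θ * Complex.I) : ℂ) = ((-(ℓ * θ) : ℝ) : ℂ) * Complex.I := by push_cast; ring
    rw [this, Complex.norm_exp_ofReal_mul_I]
  have hqe : ∀ z, q.eval z = ∑ j ∈ Finset.range (ℓ + 1), q.coeff j * z ^ j := fun z =>
    Polynomial.eval_eq_sum_range' (Nat.lt_succ_of_le hq) z
  have h1 : ∀ k : ℕ, f (greatCircle hv hw hvw (Real.pi * k / (ℓ + 1))) ^ 2 =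
      ‖∑ j ∈ Finset.range (ℓ + 1), q.coeff j * (ζ ^ k) ^ j‖ ^ 2 := by
    intro k
    rw [← sq_abs, ← Real.norm_eq_abs, ← Complex.norm_real, hfq, norm_mul, hnorm, one_mul, hz, hqe]
  -- The restriction has frequencies 2j - ℓ with 0 ≤ j ≤ ℓ, so differencing with step h multiplies
  -- coefficient j, up to phase, by `e j`, of modulus at most |2j - ℓ||h| ≤ ℓ|h|.
  set e : ℕ → ℂ := fun j => Complex.exp (Complex.I * (((2 * j - ℓ) * h : ℝ) : ℂ)) - 1 with he
  have h2 : ∀ k : ℕ, (f (greatCircle hv hw hvw (Real.pi * k / (ℓ + 1) + h)) -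
        f (greatCircle hv hw hvw (Real.pi * k / (ℓ + 1)))) ^ 2 =
      ‖∑ j ∈ Finset.range (ℓ + 1), (q.coeff j * e j) * (ζ ^ k) ^ j‖ ^ 2 := by
    intro k
    set θ : ℝ := Real.pi * k / (ℓ + 1) with hθ
    have hsum : ((f (greatCircle hv hw hvw (θ + h)) - f (greatCircle hv hw hvw θ) : ℝ) : ℂ) =
        Complex.exp (-(ℓ * θ * Complex.I)) *
          ∑ j ∈ Finset.range (ℓ + 1), (q.coeff j * e j) * (ζ ^ k) ^ j := by
      rw [Complex.ofReal_sub, hfq, hfq, hz, hqe, hqe]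
      have hs : Complex.exp (-(ℓ * ((θ + h : ℝ) : ℂ) * Complex.I)) =
          Complex.exp (-(ℓ * θ * Complex.I)) * Complex.exp (-(ℓ * h * Complex.I)) := by
        rw [← Complex.exp_add]; congr 1; push_cast; ring
      have hs2 : Complex.exp (2 * ((θ + h : ℝ) : ℂ) * Complex.I) =
          ζ ^ k * Complex.exp (2 * h * Complex.I) := by
        rw [← hz, ← hθ, ← Complex.exp_add]; congr 1; push_cast; ring
      rw [hs, hs2, mul_assoc, ← mul_sub, Finset.mul_sum, ← Finset.sum_sub_distrib]
      congr 1
      refine Finset.sum_congr rfl fun j _ => ?_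
      have hs3 : Complex.exp (Complex.I * (((2 * j - ℓ) * h : ℝ) : ℂ)) =
          Complex.exp (-(ℓ * h * Complex.I)) * Complex.exp (2 * h * Complex.I) ^ j := by
        rw [← Complex.exp_nat_mul, ← Complex.exp_add]; congr 1; push_cast; ring
      simp only [he, hs3, mul_pow]
      ring
    rw [← sq_abs, ← Real.norm_eq_abs, ← Complex.norm_real, hsum, norm_mul, hnorm, one_mul]
  simp only [h1, h2]
  rw [sum_norm_sq_sum_pow hζ, sum_norm_sq_sum_pow hζ, mul_left_comm,
    Finset.mul_sum (a := (ℓ : ℝ) ^ 2 * h ^ 2)]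
  refine mul_le_mul_of_nonneg_left (Finset.sum_le_sum fun j hj => ?_) (Nat.cast_nonneg _)
  have hj' : (j : ℝ) ≤ ℓ := by exact_mod_cast Nat.lt_succ_iff.mp (Finset.mem_range.mp hj)
  have hj0 : (0 : ℝ) ≤ j := Nat.cast_nonneg j
  have hej : ‖e j‖ ^ 2 ≤ ℓ ^ 2 * h ^ 2 := by
    have h3 : ‖e j‖ ≤ |(2 * j - ℓ) * h| := Real.norm_exp_I_mul_ofReal_sub_one_le
    calc ‖e j‖ ^ 2 ≤ |(2 * j - ℓ) * h| ^ 2 := by gcongr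
      _ = (2 * j - ℓ) ^ 2 * h ^ 2 := by rw [sq_abs, mul_pow]
      _ ≤ ℓ ^ 2 * h ^ 2 := by
        refine mul_le_mul_of_nonneg_right ?_ (sq_nonneg h)
        exact sq_le_sq' (by linarith) (by linarith)
  rw [norm_mul, mul_pow, mul_comm]
  exact mul_le_mul_of_nonneg_right hej (sq_nonneg _)

variable {Y : (ℓ : ℕ) → Order ℓ → C(Sphere2, ℝ)}

/-- By invariance the increment from `x` to `y` may be replaced by the increment from γ(θ) to γ(θ +
h) for any θ. Averaging over the sample angles allows the discrete Bernstein inequality for each m,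
and the addition theorem evaluates the right-hand side. -/
lemma IsHarmonicBasis.sum_sub_sq_le (hY : IsHarmonicBasis Y) (ℓ : ℕ) (x y : Sphere2) :
    ∑ m, (Y ℓ m x - Y ℓ m y) ^ 2 ≤
      ℓ ^ 2 * geodesicDist x y ^ 2 * ((2 * ℓ + 1) / surfaceMeasure.real Set.univ) := by
  obtain ⟨v, w, hv, hw, hvw, hx, hy⟩ := exists_orthonormal_greatCircle x y
  set h := geodesicDist x y
  set γ := greatCircle hv hw hvw
  have hconst : ∀ θ : ℝ, ∑ m, (Y ℓ m x - Y ℓ m y) ^ 2 =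
      ∑ m, (Y ℓ m (γ (θ + h)) - Y ℓ m (γ θ)) ^ 2 := by
    intro θ
    -- Reversal about (θ + h)/2 exchanges the parameters 0 and θ + h, and h and θ.
    obtain ⟨R, hR⟩ := exists_isometry_greatCircle hv hw hvw ((θ + h) / 2)
    have e0 : sphereIsometry R x = γ (θ + h) := by rw [← hx, hR]; exact congrArg γ (by ring)
    have e1 : sphereIsometry R y = γ θ := by rw [← hy, hR]; exact congrArg γ (by ring)
    rw [← e0, ← e1, hY.sum_sub_sq_isometry_apply]
  have hN : (0 : ℝ) < (ℓ + 1 : ℕ) := by positivity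
  refine le_of_mul_le_mul_left ?_ hN
  calc ((ℓ + 1 : ℕ) : ℝ) * ∑ m, (Y ℓ m x - Y ℓ m y) ^ 2
      = ∑ k ∈ Finset.range (ℓ + 1), ∑ m, (Y ℓ m (γ (Real.pi * k / (ℓ + 1) + h)) -
          Y ℓ m (γ (Real.pi * k / (ℓ + 1)))) ^ 2 := by
        rw [← Finset.sum_congr rfl fun k _ => hconst _]
        simp
    _ ≤ ∑ m, ℓ ^ 2 * h ^ 2 * ∑ k ∈ Finset.range (ℓ + 1),
          Y ℓ m (γ (Real.pi * k / (ℓ + 1))) ^ 2 := by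
        rw [Finset.sum_comm]
        exact Finset.sum_le_sum fun m _ =>
          sum_sub_sq_greatCircle_le hv hw hvw (hY.mem_sphericalHarmonics m) h
    _ = _ := by
        rw [← Finset.mul_sum, Finset.sum_comm]
        simp only [hY.sum_sq_apply, Finset.sum_const, Finset.card_range, nsmul_eq_mul]
        ring

end

/-! ### Chaining and the Kolmogorov–Chentsov theorem -/

section

section Chaining

variable {M : Type*} [PseudoMetricSpace M]

/-- The deterministic part of the chaining argument: a function whose increments over a sequence of
nets decay geometrically converges along the nets to a Hölder continuous function. -/
lemma exists_holder_limit {π : ℕ → M → M} {D α G : ℝ} (hD : 0 < D) (hα : 0 < α)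
    (hdist : ∀ x y : M, dist x y ≤ D) (hπ : ∀ n x, dist x (π n x) ≤ D * (1 / 2) ^ n) {f : M → ℝ}
    (h₁ : ∀ n x y, dist (π n x) (π n y) ≤ 3 * D * (1 / 2) ^ n →
      |f (π n x) - f (π n y)| ≤ G * ((2 : ℝ) ^ (-α)) ^ n)
    (h₂ : ∀ n x, |f (π n x) - f (π (n + 1) x)| ≤ G * ((2 : ℝ) ^ (-α)) ^ n) :
    ∃ g : M → ℝ, (∀ x, Tendsto (fun n => f (π n x)) atTop (𝓝 (g x))) ∧
      ∃ C, ∀ x y, |g x - g y| ≤ C * dist x y ^ α := by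
  set r : ℝ := (2 : ℝ) ^ (-α) with hr
  have hr0 : 0 < r := by positivity
  have hr1 : r < 1 := Real.rpow_lt_one_of_one_lt_of_neg one_lt_two (by linarith)
  have hcauchy : ∀ x, CauchySeq fun n => f (π n x) := fun x =>
    cauchySeq_of_le_geometric r G hr1 fun n => by rw [Real.dist_eq]; exact h₂ n x
  choose g hg using fun x => cauchySeq_tendsto_of_complete (hcauchy x)
  have hgn : ∀ n x, |f (π n x) - g x| ≤ G * r ^ n / (1 - r) := fun n x => by
    rw [← Real.dist_eq]
    exact dist_le_of_le_geometric_of_tendsto r G hr1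
      (fun n => by rw [Real.dist_eq]; exact h₂ n x) (hg x) n
  set K : ℝ := 2 * (G / (1 - r)) + G with hK
  -- Triangle inequality through the nets: D + D + D scales give the constant 3D, and two limit
  -- errors plus one net increment give `K`.
  have key : ∀ n x y, dist x y ≤ D * (1 / 2) ^ n → |g x - g y| ≤ K * r ^ n := by
    intro n x y hxy
    have h3 : dist (π n x) (π n y) ≤ 3 * D * (1 / 2) ^ n := by
      have := dist_triangle4 (π n x) x y (π n y)
      rw [dist_comm (π n x) x] at this
      linarith [hπ n x, hπ n y]
    have h4 := h₁ n x y h3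
    have h5 := hgn n x
    have h6 := hgn n y
    have h7 : g x - g y = -(f (π n x) - g x) + (f (π n x) - f (π n y)) + (f (π n y) - g y) := by
      ring
    rw [h7]
    refine (abs_add_three _ _ _).trans ?_
    rw [abs_neg]
    have h8 : K * r ^ n = G * r ^ n / (1 - r) + G * r ^ n + G * r ^ n / (1 - r) := by
      rw [hK]; ring
    linarith
  refine ⟨g, hg, K * (2 / D) ^ α, fun x y => ?_⟩
  have hK0 : 0 ≤ K := by
    have := (abs_nonneg _).trans (key 0 x x (by simp [hD.le]))
    simpa using this
  -- In a pseudometric space distinct points may be at distance zero; then every scale applies and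
  -- the increment vanishes.
  rcases eq_or_lt_of_le (dist_nonneg (x := x) (y := y)) with h0 | h0
  · have hle : ∀ n, |g x - g y| ≤ K * r ^ n := fun n =>
      key n x y (by rw [← h0]; positivity)
    have hlim : Tendsto (fun n : ℕ => K * r ^ n) atTop (𝓝 (K * 0)) :=
      (tendsto_pow_atTop_nhds_zero_of_lt_one hr0.le hr1).const_mul K
    have := ge_of_tendsto' hlim hle
    rw [← h0, Real.zero_rpow hα.ne']
    simpa using this
  · obtain ⟨n, hn1, hn2⟩ := exists_nat_pow_near_of_lt_one (x := dist x y / D) (y := (1 / 2 : ℝ))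
      (by positivity) ((div_le_one hD).mpr (hdist x y)) (by norm_num) (by norm_num)
    have hn2' : dist x y ≤ D * (1 / 2) ^ n := by
      rw [div_le_iff₀ hD] at hn2; linarith
    refine (key n x y hn2').trans ?_
    rw [mul_assoc]
    refine mul_le_mul_of_nonneg_left ?_ hK0
    have hrn : r ^ n = ((1 / 2 : ℝ) ^ n) ^ α := by
      rw [hr, Real.rpow_neg zero_le_two, ← Real.inv_rpow zero_le_two, ← Real.rpow_natCast,
        ← Real.rpow_mul (by norm_num), mul_comm, Real.rpow_mul (by norm_num), Real.rpow_natCast]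
      norm_num
    rw [hrn, ← Real.mul_rpow (by positivity) dist_nonneg]
    refine Real.rpow_le_rpow (by positivity) ?_ hα.le
    rw [pow_succ] at hn1
    have : 2 / D * dist x y = 2 * (dist x y / D) := by ring
    rw [this]; linarith

variable {Ω : Type*} [MeasurableSpace Ω] {P : Measure Ω}

/-- The probabilistic part of the chaining argument. -/
lemma ae_exists_increment_bound {X : M → Ω → ℝ} (hX : ∀ p, Measurable (X p)) {α γ D C₀ K : ℝ}
    (hα : α < γ) (hD : 0 < D)
    (hmom : ∀ k : ℕ, ∃ C : ℝ, 0 ≤ C ∧ ∀ p q,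
      ∫⁻ ω, ‖X p ω - X q ω‖ₑ ^ k ∂P ≤ ENNReal.ofReal (C * dist p q ^ (γ * k)))
    (hγ : 0 ≤ γ) {N : ℕ → Finset M} (hN : ∀ n, ((N n).card : ℝ) ≤ C₀ * K ^ n) :
    ∀ᵐ ω ∂P, ∃ G : ℕ, ∀ n, ∀ u ∈ N n, ∀ v ∈ N n, dist u v ≤ D * (1 / 2) ^ n →
      |X u ω - X v ω| ≤ G * ((2 : ℝ) ^ (-α)) ^ n := by
  classical
  -- The K^{2n} pairs at scale n are beaten by a sufficiently high moment, since α < γ; `1 ≤ k` is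
  -- needed to recover the increment from its power.
  obtain ⟨k, hk0, hk⟩ : ∃ k : ℕ, 1 ≤ k ∧ K ^ 2 * ((2 : ℝ) ^ (α - γ)) ^ k < 1 := by
    have hlt : (2 : ℝ) ^ (α - γ) < 1 :=
      Real.rpow_lt_one_of_one_lt_of_neg one_lt_two (by linarith)
    have hlim := (tendsto_pow_atTop_nhds_zero_of_lt_one (by positivity) hlt).const_mul (K ^ 2)
    rw [mul_zero] at hlim
    obtain ⟨k, h1, h2⟩ := ((hlim.eventually_lt_const one_pos).and (eventually_ge_atTop 1)).exists
    exact ⟨k, h2, h1⟩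
  obtain ⟨C, hC, hCX⟩ := hmom k
  set ρ : ℝ := K ^ 2 * ((2 : ℝ) ^ (α - γ)) ^ k with hρ
  have hρ0 : 0 ≤ ρ := by positivity
  set b : ℝ := ((2 : ℝ) ^ α) ^ k with hb
  let F : ℕ → Ω → ENNReal := fun n ω => ∑ u ∈ N n, ∑ v ∈ N n,
    if dist u v ≤ D * (1 / 2) ^ n then ‖X u ω - X v ω‖ₑ ^ k else 0
  have hF : ∀ n, Measurable (F n) := fun n => by
    refine Finset.measurable_fun_sum _ fun u _ => Finset.measurable_fun_sum _ fun v _ => ?_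
    split_ifs
    · exact (((hX u).sub (hX v)).enorm).pow_const k
    · exact measurable_const
  have hint : ∀ n, ∫⁻ ω, F n ω ∂P ≤
      ENNReal.ofReal ((C₀ * K ^ n) ^ 2 * (C * (D * (1 / 2) ^ n) ^ (γ * k))) := by
    intro n
    have hle : ∀ u v, ∫⁻ ω, (if dist u v ≤ D * (1 / 2) ^ n then ‖X u ω - X v ω‖ₑ ^ k else 0) ∂P ≤
        ENNReal.ofReal (C * (D * (1 / 2) ^ n) ^ (γ * k)) := by
      intro u v
      split_ifs with h
      · refine (hCX u v).trans (ENNReal.ofReal_le_ofReal ?_)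
        gcongr
      · simp
    have hm : ∀ u v, Measurable fun ω =>
        if dist u v ≤ D * (1 / 2) ^ n then ‖X u ω - X v ω‖ₑ ^ k else 0 := fun u v => by
      split_ifs
      · exact (((hX u).sub (hX v)).enorm).pow_const k
      · exact measurable_const
    calc ∫⁻ ω, F n ω ∂P = ∑ u ∈ N n, ∑ v ∈ N n,
          ∫⁻ ω, (if dist u v ≤ D * (1 / 2) ^ n then ‖X u ω - X v ω‖ₑ ^ k else 0) ∂P := by
          rw [lintegral_finsetSum _ fun u _ => Finset.measurable_fun_sum _ fun v _ => hm u v]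
          refine Finset.sum_congr rfl fun u _ => ?_
          rw [lintegral_finsetSum _ fun v _ => hm u v]
      _ ≤ ∑ u ∈ N n, ∑ v ∈ N n, ENNReal.ofReal (C * (D * (1 / 2) ^ n) ^ (γ * k)) :=
          Finset.sum_le_sum fun u _ => Finset.sum_le_sum fun v _ => hle u v
      _ = ENNReal.ofReal (((N n).card : ℝ) ^ 2 * (C * (D * (1 / 2) ^ n) ^ (γ * k))) := by
          rw [ENNReal.ofReal_mul (p := ((N n).card : ℝ) ^ 2) (by positivity),
            ENNReal.ofReal_pow (by positivity), ENNReal.ofReal_natCast]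
          simp only [Finset.sum_const, nsmul_eq_mul]
          ring
      _ ≤ _ := by
          refine ENNReal.ofReal_le_ofReal ?_
          have := hN n
          gcongr
  -- With weights b^n = 2^{αkn} the expected power sums are dominated by a geometric series of ratio
  -- ρ < 1.
  have hsum : ∫⁻ ω, ∑' n, ENNReal.ofReal (b ^ n) * F n ω ∂P ≠ ⊤ := by
    rw [lintegral_tsum fun n => ((hF n).const_mul _).aemeasurable]
    have hle : ∀ n, ∫⁻ ω, ENNReal.ofReal (b ^ n) * F n ω ∂P ≤
        ENNReal.ofReal (C₀ ^ 2 * C * D ^ (γ * k) * ρ ^ n) := by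
      intro n
      rw [lintegral_const_mul _ (hF n)]
      refine (mul_le_mul_right (hint n) _).trans ?_
      rw [← ENNReal.ofReal_mul (by positivity)]
      refine le_of_eq (congrArg _ ?_)
      have e1 : ((1 / 2 : ℝ) ^ n) ^ (γ * k) = (((2 : ℝ) ^ (-γ)) ^ k) ^ n := by
        rw [one_div, inv_pow, Real.inv_rpow (by positivity), ← Real.rpow_neg (by positivity),
          ← Real.rpow_natCast, ← Real.rpow_mul zero_le_two, ← Real.rpow_natCast,
          ← Real.rpow_natCast, ← Real.rpow_mul zero_le_two, ← Real.rpow_mul zero_le_two]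
        congr 1; ring
      have e2 : (2 : ℝ) ^ (α - γ) = 2 ^ α * 2 ^ (-γ) := by
        rw [← Real.rpow_add two_pos]; rfl
      rw [Real.mul_rpow hD.le (by positivity), e1, hρ, hb, e2]
      simp only [mul_pow]
      ring
    refine ne_top_of_le_ne_top ?_ (ENNReal.tsum_le_tsum hle)
    rw [← ENNReal.ofReal_tsum_of_nonneg (fun n => by positivity)
      ((summable_geometric_of_lt_one hρ0 hk).mul_left _)]
    exact ENNReal.ofReal_ne_top
  have hae := ae_lt_top (Measurable.tsum fun n => (hF n).const_mul _) hsum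
  filter_upwards [hae] with ω hω
  set S := ∑' n, ENNReal.ofReal (b ^ n) * F n ω with hS
  -- From a^k ≤ S follows a ≤ max 1 S, so no k-th root is needed. An integer bound later allows a
  -- countable union.
  refine ⟨⌈max 1 S.toReal⌉₊, fun n u hu v hv huv => ?_⟩
  have h1 : ENNReal.ofReal (b ^ n) * ‖X u ω - X v ω‖ₑ ^ k ≤ S := by
    refine le_trans (mul_le_mul_right ?_ _) (ENNReal.le_tsum n)
    have h2 : (if dist u v ≤ D * (1 / 2) ^ n then ‖X u ω - X v ω‖ₑ ^ k else 0) ≤ F n ω :=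
      (Finset.single_le_sum (f := fun v => if dist u v ≤ D * (1 / 2) ^ n then
        ‖X u ω - X v ω‖ₑ ^ k else 0) (fun _ _ => zero_le) hv).trans
        (Finset.single_le_sum (f := fun u => ∑ v ∈ N n, if dist u v ≤ D * (1 / 2) ^ n then
        ‖X u ω - X v ω‖ₑ ^ k else 0) (fun _ _ => zero_le) hu)
    rwa [if_pos huv] at h2
  have h3 : (((2 : ℝ) ^ α) ^ n * |X u ω - X v ω|) ^ k ≤ S.toReal := by
    have h4 := ENNReal.toReal_mono hω.ne h1
    rw [ENNReal.toReal_mul, ENNReal.toReal_ofReal (by positivity), ENNReal.toReal_pow,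
      toReal_enorm, Real.norm_eq_abs] at h4
    rw [mul_pow, ← pow_mul, mul_comm n k, pow_mul]
    exact h4
  have h5 : ((2 : ℝ) ^ α) ^ n * |X u ω - X v ω| ≤ max 1 S.toReal := by
    by_cases hle : ((2 : ℝ) ^ α) ^ n * |X u ω - X v ω| ≤ 1
    · exact hle.trans (le_max_left _ _)
    · exact ((le_self_pow₀ (not_le.mp hle).le (by omega)).trans h3).trans (le_max_right _ _)
  rw [Real.rpow_neg zero_le_two, inv_pow, ← div_eq_mul_inv, le_div_iff₀ (by positivity), mul_comm]
  exact h5.trans (Nat.le_ceil _)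

/-- **Kolmogorov–Chentsov theorem** over a bounded metric space with nets of polynomial growth, for
processes with increments that have moments of all orders. -/
theorem exists_holder_modification [IsFiniteMeasure P] {X : M → Ω → ℝ}
    (hX : ∀ p, Measurable (X p))
    {γ D C₀ K : ℝ} (hγ : 0 < γ) (hD : 0 < D)
    (hmom : ∀ k : ℕ, ∃ C : ℝ, 0 ≤ C ∧ ∀ p q,
      ∫⁻ ω, ‖X p ω - X q ω‖ₑ ^ k ∂P ≤ ENNReal.ofReal (C * dist p q ^ (γ * k)))
    (hdist : ∀ x y : M, dist x y ≤ D) {π : ℕ → M → M}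
    (hπ : ∀ n x, dist x (π n x) ≤ D * (1 / 2) ^ n)
    {N : ℕ → Finset M} (hπN : ∀ n x, π n x ∈ N n) (hN : ∀ n, ((N n).card : ℝ) ≤ C₀ * K ^ n) :
    ∃ Z : M → Ω → ℝ, (∀ p, Measurable (Z p)) ∧ (∀ p, Z p =ᵐ[P] X p) ∧
      ∀ ω, ∀ α, 0 < α → α < γ → ∃ C : ℝ, ∀ p q, |Z p ω - Z q ω| ≤ C * dist p q ^ α := by
  classical
  -- Joining consecutive nets handles both increments within a level and the passage from level n to
  -- n + 1.
  set N' : ℕ → Finset M := fun n => N n ∪ N (n + 1) with hN'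
  have hN'card : ∀ n, ((N' n).card : ℝ) ≤ (C₀ + C₀ * K) * K ^ n := fun n => by
    have h : ((N' n).card : ℝ) ≤ (N n).card + (N (n + 1)).card := by
      exact_mod_cast Finset.card_union_le _ _
    have h1 := hN n
    have h2 := hN (n + 1)
    rw [pow_succ] at h2
    linarith
  -- A sequence of exponents increasing to γ, so that one event of full measure serves all α < γ.
  set a : ℕ → ℝ := fun j => γ * (1 - 1 / ((j : ℝ) + 2)) with ha
  have ha0 : ∀ j, 0 < a j := fun j => by
    have : 1 / ((j : ℝ) + 2) < 1 := by
      rw [div_lt_one (by positivity)]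
      linarith [Nat.cast_nonneg (α := ℝ) j]
    exact mul_pos hγ (by linarith)
  have haγ : ∀ j, a j < γ := fun j => by
    have : 0 < 1 / ((j : ℝ) + 2) := by positivity
    show γ * (1 - 1 / ((j : ℝ) + 2)) < γ
    nlinarith
  have hatend : Tendsto a atTop (𝓝 γ) := by
    have h1 : Tendsto (fun j : ℕ => ((j : ℝ) + 2)) atTop atTop :=
      tendsto_atTop_add_const_right _ _ tendsto_natCast_atTop_atTop
    have h2 := (tendsto_const_nhds (x := (1 : ℝ))).div_atTop h1
    have h3 := ((tendsto_const_nhds (x := (1 : ℝ))).sub h2).const_mul γ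
    rwa [sub_zero, mul_one] at h3
  let Good : Set Ω := ⋂ j : ℕ, ⋃ G : ℕ, ⋂ n : ℕ, ⋂ u ∈ N' n, ⋂ v ∈ N' n,
    {ω | dist u v ≤ 3 * D * (1 / 2) ^ n → |X u ω - X v ω| ≤ G * ((2 : ℝ) ^ (-(a j))) ^ n}
  have hGmeas : MeasurableSet Good := by
    refine .iInter fun j => .iUnion fun G => .iInter fun n => ?_
    refine Finset.measurableSet_biInter _ fun u _ => Finset.measurableSet_biInter _ fun v _ => ?_
    by_cases h : dist u v ≤ 3 * D * (1 / 2) ^ n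
    · simp only [h, true_imp_iff]
      exact measurableSet_le ((hX u).sub (hX v)).abs measurable_const
    · simp only [h, false_imp_iff]
      exact MeasurableSet.const _
  have hGae : ∀ᵐ ω ∂P, ω ∈ Good := by
    have := ae_all_iff.mpr fun j => ae_exists_increment_bound hX (haγ j)
      (by positivity : 0 < 3 * D) hmom hγ.le hN'card
    filter_upwards [this] with ω hω
    simpa only [Good, Set.mem_iInter, Set.mem_iUnion, Set.mem_ofPred_eq] using hω
  have hlim : ∀ ω ∈ Good, ∀ j, ∃ g : M → ℝ,
      (∀ x, Tendsto (fun n => X (π n x) ω) atTop (𝓝 (g x))) ∧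
      ∃ C, ∀ x y, |g x - g y| ≤ C * dist x y ^ (a j) := by
    intro ω hω j
    simp only [Good, Set.mem_iInter, Set.mem_iUnion, Set.mem_ofPred_eq] at hω
    obtain ⟨G, hG⟩ := hω j
    refine exists_holder_limit (f := fun p => X p ω) hD (ha0 j) hdist hπ (G := G) ?_ ?_
    · exact fun n x y h => hG n _ (Finset.mem_union_left _ (hπN n x)) _
        (Finset.mem_union_left _ (hπN n y)) h
    · refine fun n x => hG n _ (Finset.mem_union_left _ (hπN n x)) _
        (Finset.mem_union_right _ (hπN (n + 1) x)) ?_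
      have h1 := hπ n x
      have h2 := hπ (n + 1) x
      have h3 := dist_triangle_left (π n x) (π (n + 1) x) x
      have h4 : 0 ≤ D * (1 / 2 : ℝ) ^ n := by positivity
      rw [pow_succ] at h2
      linarith
  -- Limits along the nets on the good event, zero elsewhere: every path is then regular, not merely
  -- almost every one.
  set Z : M → Ω → ℝ := fun p => Good.indicator fun ω => limUnder atTop fun n => X (π n p) ω with hZ
  have hZlim : ∀ p ω, Tendsto (fun n => Good.indicator (X (π n p)) ω) atTop (𝓝 (Z p ω)) := by
    intro p ω
    by_cases hω : ω ∈ Good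
    · obtain ⟨g, hg, -⟩ := hlim ω hω 0
      simp only [hZ, Set.indicator_of_mem hω]
      exact tendsto_nhds_limUnder ⟨_, hg p⟩
    · simp only [hZ, Set.indicator_of_notMem hω]
      exact tendsto_const_nhds
  refine ⟨Z, fun p => ?_, fun p => ?_, fun ω α hα hαγ => ?_⟩
  · exact measurable_of_tendsto_metrizable (fun n => (hX (π n p)).indicator hGmeas)
      (tendsto_pi_nhds.mpr (hZlim p))
  -- First moments of X(π n p) - X(p) are summable, so the values along the nets converge almost
  -- surely to X(p) itself.
  · obtain ⟨C, hC, hCX⟩ := hmom 1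
    have hmeas : ∀ n, Measurable fun ω => ‖X (π n p) ω - X p ω‖ₑ := fun n =>
      ((hX (π n p)).sub (hX p)).enorm
    have hsum : ∫⁻ ω, ∑' n, ‖X (π n p) ω - X p ω‖ₑ ∂P ≠ ⊤ := by
      rw [lintegral_tsum fun n => (hmeas n).aemeasurable]
      have hle : ∀ n, ∫⁻ ω, ‖X (π n p) ω - X p ω‖ₑ ∂P ≤
          ENNReal.ofReal (C * D ^ γ * ((1 / 2 : ℝ) ^ γ) ^ n) := by
        intro n
        have h := hCX (π n p) p
        simp only [pow_one, Nat.cast_one, mul_one] at h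
        refine h.trans (ENNReal.ofReal_le_ofReal ?_)
        have h2 : dist (π n p) p ^ γ ≤ (D * (1 / 2) ^ n) ^ γ := by
          rw [dist_comm]
          exact Real.rpow_le_rpow dist_nonneg (hπ n p) hγ.le
        have e1 : ((1 / 2 : ℝ) ^ n) ^ γ = ((1 / 2 : ℝ) ^ γ) ^ n := by
          rw [← Real.rpow_natCast, ← Real.rpow_mul (by norm_num), mul_comm,
            Real.rpow_mul (by norm_num), Real.rpow_natCast]
        rw [Real.mul_rpow hD.le (by positivity), e1] at h2
        calc C * dist (π n p) p ^ γ ≤ C * (D ^ γ * ((1 / 2 : ℝ) ^ γ) ^ n) := by gcongr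
          _ = _ := by ring
      refine ne_top_of_le_ne_top ?_ (ENNReal.tsum_le_tsum hle)
      rw [← ENNReal.ofReal_tsum_of_nonneg (fun n => by positivity)
        ((summable_geometric_of_lt_one (by positivity)
          (Real.rpow_lt_one (by norm_num) (by norm_num) hγ)).mul_left _)]
      exact ENNReal.ofReal_ne_top
    have hae := ae_lt_top (Measurable.tsum hmeas) hsum
    filter_upwards [hae, hGae] with ω h1 h2
    have h3 := ENNReal.tendsto_atTop_zero_of_tsum_ne_top h1.ne
    have h4 : Tendsto (fun n => X (π n p) ω) atTop (𝓝 (X p ω)) := by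
      rw [tendsto_iff_edist_tendsto_0]
      simpa only [edist_eq_enorm_sub] using h3
    have h5 := hZlim p ω
    simp only [Set.indicator_of_mem h2] at h5
    exact tendsto_nhds_unique h5 h4
  · by_cases hω : ω ∈ Good
    · obtain ⟨j, hj⟩ := (hatend.eventually (lt_mem_nhds hαγ)).exists
      obtain ⟨g, hg, C, hC⟩ := hlim ω hω j
      have hZg : ∀ p, Z p ω = g p := fun p => by
        have := hZlim p ω
        simp only [Set.indicator_of_mem hω] at this
        exact tendsto_nhds_unique this (hg p)
      refine ⟨|C| * D ^ (a j - α), fun p q => ?_⟩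
      rw [hZg, hZg]
      refine (hC p q).trans ?_
      have h1 : dist p q ^ a j ≤ D ^ (a j - α) * dist p q ^ α := by
        have e : a j = (a j - α) + α := by ring
        conv_lhs => rw [e, Real.rpow_add_of_nonneg dist_nonneg (by linarith) hα.le]
        have := Real.rpow_le_rpow dist_nonneg (hdist p q) (by linarith : 0 ≤ a j - α)
        gcongr
      calc C * dist p q ^ a j ≤ |C| * dist p q ^ a j := by
            gcongr; exact le_abs_self C
        _ ≤ |C| * (D ^ (a j - α) * dist p q ^ α) := by gcongr
        _ = _ := by ring
    · refine ⟨0, fun p q => ?_⟩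
      simp [hZ, Set.indicator_of_notMem hω]

end Chaining

/-- A space with a Lipschitz-coercive bounded map into a cube has nets of polynomial growth. -/
lemma exists_nets {M : Type*} [PseudoMetricSpace M] [Nonempty M] {d : ℕ} (φ : M → Fin d → ℝ)
    {R c : ℝ} (hR : 0 ≤ R) (hφ : ∀ x i, |φ x i| ≤ R)
    (hc : ∀ (x y : M) (δ : ℝ), (∀ i, |φ x i - φ y i| ≤ δ) → dist x y ≤ c * δ) :
    ∃ (π : ℕ → M → M) (N : ℕ → Finset M) (C₀ K : ℝ),
      (∀ n x, dist x (π n x) ≤ c * (1 / 2) ^ n) ∧ (∀ n x, π n x ∈ N n) ∧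
      ∀ n, ((N n).card : ℝ) ≤ C₀ * K ^ n := by
  classical
  -- The dyadic cell of a point at scale 2^{-n}; `Function.invFun` picks one representative of each
  -- occupied cell.
  let f : ℕ → M → Fin d → ℤ := fun n x i => ⌊2 ^ n * φ x i⌋
  let B : ℕ → Finset (Fin d → ℤ) := fun n =>
    Fintype.piFinset fun _ => Finset.Icc ⌊-(2 ^ n * R)⌋ ⌊2 ^ n * R⌋
  refine ⟨fun n x => Function.invFun (f n) (f n x), fun n => (B n).image (Function.invFun (f n)),
    (2 * R + 2) ^ d, 2 ^ d, fun n x => ?_, fun n x => ?_,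
    fun n => ?_⟩
  · have h : f n (Function.invFun (f n) (f n x)) = f n x := Function.invFun_eq ⟨x, rfl⟩
    refine hc _ _ _ fun i => ?_
    have hi : ⌊2 ^ n * φ x i⌋ = ⌊2 ^ n * φ (Function.invFun (f n) (f n x)) i⌋ :=
      (congrFun h i).symm
    have h1 := (Int.abs_sub_lt_one_of_floor_eq_floor hi).le
    rw [← mul_sub, abs_mul, abs_of_pos (by positivity : (0 : ℝ) < 2 ^ n)] at h1
    rw [one_div, inv_pow, ← one_div, le_div_iff₀ (by positivity), mul_comm]
    exact h1
  · refine Finset.mem_image_of_mem _ (Fintype.mem_piFinset.mpr fun i => Finset.mem_Icc.mpr ?_)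
    have h := abs_le.mp (hφ x i)
    have h2 : (0 : ℝ) < 2 ^ n := by positivity
    constructor
    · exact Int.floor_le_floor (by nlinarith)
    · exact Int.floor_le_floor (by nlinarith)
  · have h1 : (((B n).image (Function.invFun (f n))).card : ℝ) ≤ (B n).card := by
      exact_mod_cast Finset.card_image_le
    refine h1.trans ?_
    rw [Fintype.card_piFinset_const, Nat.cast_pow, ← pow_mul, mul_comm d n, pow_mul, ← mul_pow]
    refine pow_le_pow_left₀ (Nat.cast_nonneg _) ?_ d
    rw [Int.card_Icc]
    have h2 : (1 : ℝ) ≤ 2 ^ n := one_le_pow₀ one_le_two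
    have h3 : ⌊-(2 ^ n * R)⌋ ≤ ⌊2 ^ n * R⌋ := Int.floor_le_floor (by
      have : 0 ≤ 2 ^ n * R := by positivity
      linarith)
    have h4 : ((⌊2 ^ n * R⌋ + 1 - ⌊-(2 ^ n * R)⌋).toNat : ℝ) =
        ⌊2 ^ n * R⌋ + 1 - ⌊-(2 ^ n * R)⌋ := by
      have : ((⌊2 ^ n * R⌋ + 1 - ⌊-(2 ^ n * R)⌋).toNat : ℤ) =
        ⌊2 ^ n * R⌋ + 1 - ⌊-(2 ^ n * R)⌋ := Int.toNat_of_nonneg (by omega)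
      exact_mod_cast this
    rw [h4]
    have h5 := Int.floor_le (2 ^ n * R)
    have h6 := (Int.lt_floor_add_one (-(2 ^ n * R))).le
    linarith

end

/-! ### Gaussian moments, covariance computations and increment estimates -/

section

instance instSecondCountableTopologyL2Sphere : SecondCountableTopology L2Sphere := by
  have : Fact ((2 : ENNReal) ≠ ⊤) := ⟨by norm_num⟩
  have : SFinite surfaceMeasure := inferInstance
  have : IsSeparable surfaceMeasure := inferInstance
  exact Lp.SecondCountableTopology

section GaussianMoments

variable {Ω : Type*} [MeasurableSpace Ω] {P : Measure Ω}

/-- The absolute moments of the standard Gaussian law. -/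
def gaussianMoment (k : ℕ) : ENNReal := ∫⁻ x, ‖x‖ₑ ^ k ∂gaussianReal 0 1

lemma gaussianMoment_ne_top (k : ℕ) : gaussianMoment k ≠ ⊤ := by
  have h := (memLp_id_gaussianReal (μ := 0) (v := 1) k).eLpNorm_lt_top
  rcases Nat.eq_zero_or_pos k with rfl | hk
  · simp [gaussianMoment]
  · have h2 := lintegral_rpow_enorm_lt_top_of_eLpNorm_lt_top (p := (k : NNReal))
      (by exact_mod_cast hk.ne') ENNReal.coe_ne_top h
    simpa [gaussianMoment] using h2.ne

/-- A centred Gaussian is its standard deviation times a standard one, so a variance bound controls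
every moment. -/
lemma lintegral_enorm_pow_le_of_hasGaussianLaw {W : Ω → ℝ} (hW : HasGaussianLaw W P)
    (hmean : ∫ ω, W ω ∂P = 0) {b : ℝ} (hb : 0 ≤ b) (hvar : ∫ ω, W ω ^ 2 ∂P ≤ b ^ 2) (k : ℕ) :
    ∫⁻ ω, ‖W ω‖ₑ ^ k ∂P ≤ gaussianMoment k * ENNReal.ofReal (b ^ k) := by
  have hmap := hW.map_eq_gaussianReal
  have hv : Var[W; P] = ∫ ω, W ω ^ 2 ∂P :=
    variance_of_integral_eq_zero hW.aemeasurable hmean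
  set v := Var[W; P] with hvdef
  have hv0 : 0 ≤ v := variance_nonneg _ _
  have hmap2 : P.map W = (gaussianReal 0 1).map (fun x => √v * x) := by
    rw [hmap, gaussianReal_map_const_mul, hmean, mul_zero, mul_one]
    congr 1
    ext
    simp [Real.sq_sqrt hv0, hv0]
  calc ∫⁻ ω, ‖W ω‖ₑ ^ k ∂P = ∫⁻ x, ‖x‖ₑ ^ k ∂(P.map W) :=
        (lintegral_map' (f := fun x : ℝ => ‖x‖ₑ ^ k) (by fun_prop) hW.aemeasurable).symm
    _ = ∫⁻ x, ‖√v * x‖ₑ ^ k ∂gaussianReal 0 1 := by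
        rw [hmap2, lintegral_map (by fun_prop) (by fun_prop)]
    _ = gaussianMoment k * ENNReal.ofReal (√v ^ k) := by
        simp only [enorm_mul, mul_pow]
        rw [lintegral_const_mul _ (by fun_prop), gaussianMoment, mul_comm,
          ENNReal.ofReal_pow (Real.sqrt_nonneg _), Real.enorm_of_nonneg (Real.sqrt_nonneg _)]
    _ ≤ _ := by
        have h : √v ≤ b := Real.sqrt_le_iff.mpr ⟨hb, hv ▸ hvar⟩
        gcongr

end GaussianMoments

variable {Ω : Type*} [MeasurableSpace Ω] {P : Measure Ω} {T H : ℝ} {Q : L2Sphere →L[ℝ] L2Sphere}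
  {B : Set.Icc (0 : ℝ) T → Ω → L2Sphere}

namespace IsQfBm

lemma hasGaussianLaw_inner_sub (hB : IsQfBm P T H Q B) (s t : Set.Icc (0 : ℝ) T)
    (u v : L2Sphere) :
    HasGaussianLaw (fun ω => inner ℝ (B t ω) u - inner ℝ (B s ω) v) P := by
  have h := (hB.gaussian.hasGaussianLaw_prodMk (s := t) (t := s)).map
    ((innerSL ℝ u).comp (ContinuousLinearMap.fst ℝ L2Sphere L2Sphere) -
      (innerSL ℝ v).comp (ContinuousLinearMap.snd ℝ L2Sphere L2Sphere))
  refine h.congr (.of_forall fun ω => ?_)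
  simp [real_inner_comm]

lemma hasGaussianLaw_inner (hB : IsQfBm P T H Q B) (t : Set.Icc (0 : ℝ) T) (u : L2Sphere) :
    HasGaussianLaw (fun ω => inner ℝ (B t ω) u) P := by
  simpa using hB.hasGaussianLaw_inner_sub t t u 0

lemma memLp_inner (hB : IsQfBm P T H Q B) (t : Set.Icc (0 : ℝ) T) (u : L2Sphere) :
    MemLp (fun ω => inner ℝ (B t ω) u) 2 P := (hB.hasGaussianLaw_inner t u).memLp_two

lemma integral_inner_sq (hB : IsQfBm P T H Q B) (hH : 0 < H) (t : Set.Icc (0 : ℝ) T)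
    (u : L2Sphere) :
    ∫ ω, inner ℝ (B t ω) u ^ 2 ∂P = (t : ℝ) ^ (2 * H) * inner ℝ (Q u) u := by
  simp only [sq, hB.cov t t u u]
  have : (2 * H) ≠ 0 := by positivity
  rw [fbmCov, sub_self, abs_zero, Real.zero_rpow this]
  ring

lemma integral_inner_sub_sq (hB : IsQfBm P T H Q B) (hH : 0 < H) (s t : Set.Icc (0 : ℝ) T)
    (u : L2Sphere) :
    ∫ ω, (inner ℝ (B t ω) u - inner ℝ (B s ω) u) ^ 2 ∂P =
      |(t : ℝ) - s| ^ (2 * H) * inner ℝ (Q u) u := by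
  have h1 := hB.memLp_inner t u
  have h2 := hB.memLp_inner s u
  have e : ∀ ω, (inner ℝ (B t ω) u - inner ℝ (B s ω) u) ^ 2 =
      inner ℝ (B t ω) u ^ 2 - 2 * (inner ℝ (B t ω) u * inner ℝ (B s ω) u) +
        inner ℝ (B s ω) u ^ 2 := fun ω => by ring
  simp only [e]
  have h3 : Integrable (fun ω => 2 * (inner ℝ (B t ω) u * inner ℝ (B s ω) u)) P :=
    (h1.integrable_mul h2).const_mul 2
  have h4 := h1.integrable_sq
  have h5 := h2.integrable_sq
  have h6 := hB.cov s t u u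
  have h7 : Integrable (fun ω => inner ℝ (B t ω) u ^ 2 -
      2 * (inner ℝ (B t ω) u * inner ℝ (B s ω) u)) P := h4.sub h3
  rw [integral_add h7 h5, integral_sub h4 h3, integral_const_mul]
  rw [hB.integral_inner_sq hH, hB.integral_inner_sq hH]
  rw [h6, fbmCov, abs_sub_comm]
  ring

/-- A second moment bound for a space-time increment. -/
lemma integral_inner_sub_sq_le (hB : IsQfBm P T H Q B) (hH : 0 < H) (s t : Set.Icc (0 : ℝ) T)
    (u v : L2Sphere) :
    ∫ ω, (inner ℝ (B t ω) u - inner ℝ (B s ω) v) ^ 2 ∂P ≤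
      2 * (|(t : ℝ) - s| ^ (2 * H) * inner ℝ (Q u) u) +
        2 * ((s : ℝ) ^ (2 * H) * inner ℝ (Q (u - v)) (u - v)) := by
  rw [← hB.integral_inner_sub_sq hH, ← hB.integral_inner_sq hH, ← integral_const_mul,
    ← integral_const_mul]
  have h1 : Integrable (fun ω => 2 * (inner ℝ (B t ω) u - inner ℝ (B s ω) u) ^ 2) P :=
    ((hB.memLp_inner t u).sub (hB.memLp_inner s u)).integrable_sq.const_mul 2
  have h2 := (hB.memLp_inner s (u - v)).integrable_sq.const_mul 2
  rw [← integral_add h1 h2]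
  refine integral_mono ((hB.memLp_inner t u).sub (hB.memLp_inner s v)).integrable_sq
    (h1.add h2) fun ω => ?_
  simp only [inner_sub_right]
  set a : ℝ := inner ℝ (B t ω) u
  set b : ℝ := inner ℝ (B s ω) u
  set c : ℝ := inner ℝ (B s ω) v
  nlinarith [sq_nonneg ((a - b) - (b - c))]

end IsQfBm

variable {Y : (ℓ : ℕ) → Order ℓ → C(Sphere2, ℝ)} {A : ℕ → ℝ} {η : ℝ}

lemma HasAngularPowerSpectrum.apply_toL2 (hQ : HasAngularPowerSpectrum Y A Q)
    (hY : IsHarmonicBasis Y) (p : (ℓ : ℕ) × Order ℓ) :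
    Q (toL2 (Y p.1 p.2)) = A p.1 • toL2 (Y p.1 p.2) := by
  refine (hQ (toL2 (Y p.1 p.2))).unique ?_
  have h := hasSum_single (f := fun q : (ℓ : ℕ) × Order ℓ =>
    (A q.1 * inner ℝ (toL2 (Y q.1 q.2)) (toL2 (Y p.1 p.2))) • toL2 (Y q.1 q.2)) p
    fun q hq => by
      have h0 : inner ℝ (toL2 (Y q.1 q.2)) (toL2 (Y p.1 p.2)) = 0 := hY.orthonormal.2 hq
      rw [h0, mul_zero, zero_smul]
  have h1 : inner ℝ (toL2 (Y p.1 p.2)) (toL2 (Y p.1 p.2)) = 1 := by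
    rw [real_inner_self_eq_norm_sq]
    have : ‖toL2 (Y p.1 p.2)‖ = 1 := hY.orthonormal.1 p
    rw [this, one_pow]
  rw [h1, mul_one] at h
  exact h

/-- `Q` is diagonal in the harmonics, so covariances of finite expansions split by degree. -/
lemma HasAngularPowerSpectrum.inner_sum (hQ : HasAngularPowerSpectrum Y A Q)
    (hY : IsHarmonicBasis Y) (s : Finset ℕ) (a b : (p : (ℓ : ℕ) × Order ℓ) → ℝ) :
    inner ℝ (Q (∑ p ∈ s.sigma fun _ => Finset.univ, a p • toL2 (Y p.1 p.2)))
        (∑ p ∈ s.sigma fun _ => Finset.univ, b p • toL2 (Y p.1 p.2)) =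
      ∑ ℓ ∈ s, A ℓ * ∑ m, a ⟨ℓ, m⟩ * b ⟨ℓ, m⟩ := by
  have h : Q (∑ p ∈ s.sigma fun _ => Finset.univ, a p • toL2 (Y p.1 p.2)) =
      ∑ p ∈ s.sigma fun _ => Finset.univ, (A p.1 * a p) • toL2 (Y p.1 p.2) := by
    rw [map_sum]
    refine Finset.sum_congr rfl fun p _ => ?_
    rw [map_smul, hQ.apply_toL2 hY, smul_smul, mul_comm]
  rw [h]
  refine (hY.orthonormal.inner_sum _ _ _).trans ?_
  rw [Finset.sum_sigma]
  refine Finset.sum_congr rfl fun ℓ _ => ?_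
  rw [Finset.mul_sum]
  exact Finset.sum_congr rfl fun m _ => by simp [mul_assoc]

/-- The representer in `L²(𝕊²)` of the evaluation at `x` of the components of degree in `s`. -/
def evalVec (Y : (ℓ : ℕ) → Order ℓ → C(Sphere2, ℝ)) (s : Finset ℕ) (x : Sphere2) : L2Sphere :=
  ∑ p ∈ s.sigma fun _ => Finset.univ, Y p.1 p.2 x • toL2 (Y p.1 p.2)

lemma inner_evalVec (u : L2Sphere) (s : Finset ℕ) (x : Sphere2) :
    inner ℝ u (evalVec Y s x) = ∑ ℓ ∈ s, ∑ m, inner ℝ u (toL2 (Y ℓ m)) * Y ℓ m x := by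
  rw [evalVec, _root_.inner_sum, Finset.sum_sigma]
  simp only [inner_smul_right, mul_comm]

lemma partialExpansion_eq {Ω : Type*} {B : Set.Icc (0 : ℝ) T → Ω → L2Sphere} (L : ℕ) (p : SpaceTime T) (ω : Ω) :
    partialExpansion Y B L p ω = inner ℝ (B p.1 ω) (evalVec Y (Finset.range L) p.2) :=
  (inner_evalVec _ _ _).symm

/-- The variance at time one of the component of degree `ℓ`. -/
def degreeVariance (A : ℕ → ℝ) (ℓ : ℕ) : ℝ :=
  A ℓ * ((2 * ℓ + 1) / surfaceMeasure.real Set.univ)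

/-- The addition theorem removes the dependence on `x`. -/
lemma inner_evalVec_self (hQ : HasAngularPowerSpectrum Y A Q) (hY : IsHarmonicBasis Y)
    (s : Finset ℕ) (x : Sphere2) :
    inner ℝ (Q (evalVec Y s x)) (evalVec Y s x) = ∑ ℓ ∈ s, degreeVariance A ℓ := by
  refine (hQ.inner_sum hY s (fun p => Y p.1 p.2 x) fun p => Y p.1 p.2 x).trans ?_
  refine Finset.sum_congr rfl fun ℓ _ => ?_
  simp only [← sq, hY.sum_sq_apply, degreeVariance]

lemma SummabilityCondition.degreeVariance_nonneg (hA : SummabilityCondition A η) (ℓ : ℕ) :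
    0 ≤ degreeVariance A ℓ :=
  mul_nonneg (hA.nonneg ℓ) (div_nonneg (by positivity) surfaceMeasure_real_univ_pos.le)

lemma SummabilityCondition.summable_degreeVariance (hA : SummabilityCondition A η) :
    Summable (degreeVariance A) := by
  refine Summable.of_norm_bounded_eventually_nat
    (hA.summable.mul_left (3 / surfaceMeasure.real Set.univ)) ?_
  filter_upwards [eventually_ge_atTop 1] with ℓ hℓ
  rw [Real.norm_of_nonneg (hA.degreeVariance_nonneg ℓ), degreeVariance]
  have hℓ' : (1 : ℝ) ≤ ℓ := by exact_mod_cast hℓ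
  have h1 : (2 * ℓ + 1 : ℝ) ≤ 3 * (ℓ : ℝ) ^ (1 + η) := by
    have := Real.rpow_le_rpow_of_exponent_le hℓ' (by linarith [hA.pos] : (1 : ℝ) ≤ 1 + η)
    rw [Real.rpow_one] at this
    linarith
  have hσ := surfaceMeasure_real_univ_pos
  have := hA.nonneg ℓ
  calc A ℓ * ((2 * ℓ + 1) / surfaceMeasure.real Set.univ)
      ≤ A ℓ * ((3 * (ℓ : ℝ) ^ (1 + η)) / surfaceMeasure.real Set.univ) := by gcongr
    _ = _ := by ring

lemma geodesicDist_nonneg (x y : Sphere2) : 0 ≤ geodesicDist x y := Real.arccos_nonneg _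

/-- The interpolated increment bound for the spherical harmonics of degree `ℓ`. -/
lemma IsHarmonicBasis.sum_sub_sq_le_rpow (hY : IsHarmonicBasis Y) {γ : ℝ} (hγ0 : 0 < γ)
    (hγ1 : γ ≤ 1) (ℓ : ℕ) (x y : Sphere2) :
    ∑ m, (Y ℓ m x - Y ℓ m y) ^ 2 ≤
      4 * (ℓ * geodesicDist x y) ^ (2 * γ) * ((2 * ℓ + 1) / surfaceMeasure.real Set.univ) := by
  set κ : ℝ := (2 * ℓ + 1) / surfaceMeasure.real Set.univ with hκ
  have hκ0 : 0 ≤ κ := div_nonneg (by positivity) surfaceMeasure_real_univ_pos.le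
  set z : ℝ := ℓ * geodesicDist x y with hz
  have hz0 : 0 ≤ z := mul_nonneg (Nat.cast_nonneg _) (geodesicDist_nonneg x y)
  have h1 : ∑ m, (Y ℓ m x - Y ℓ m y) ^ 2 ≤ 4 * κ := by
    calc ∑ m, (Y ℓ m x - Y ℓ m y) ^ 2 ≤ ∑ m, (2 * Y ℓ m x ^ 2 + 2 * Y ℓ m y ^ 2) :=
          Finset.sum_le_sum fun m _ => by nlinarith [sq_nonneg (Y ℓ m x + Y ℓ m y)]
      _ = 4 * κ := by
          rw [Finset.sum_add_distrib, ← Finset.mul_sum, ← Finset.mul_sum, hY.sum_sq_apply,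
            hY.sum_sq_apply]
          ring
  have h2 : ∑ m, (Y ℓ m x - Y ℓ m y) ^ 2 ≤ z ^ 2 * κ := by
    have := hY.sum_sub_sq_le ℓ x y
    rwa [← mul_pow] at this
  -- The sum is at most κ min(4, z²), and min(4, z²) ≤ 4 z^{2γ} since 0 < γ ≤ 1.
  rcases le_total z 1 with hz1 | hz1
  · have h3 : z ^ 2 ≤ z ^ (2 * γ) := by
      rw [← Real.rpow_natCast]
      exact Real.rpow_le_rpow_of_exponent_ge_of_imp hz0 hz1 (by push_cast; linarith)
        (fun _ h => absurd h (by positivity))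
    have h4 := Real.rpow_nonneg hz0 (2 * γ)
    nlinarith
  · have h3 : 1 ≤ z ^ (2 * γ) := Real.one_le_rpow hz1 (by linarith)
    nlinarith

/-- Since 2γ ≤ η, ℓ^{2γ}(2ℓ+1) ≤ 3ℓ^{1+η}; with the factor 4 of the interpolated bound this gives
12, uniformly in the set of degrees. -/
lemma inner_evalVec_sub (hQ : HasAngularPowerSpectrum Y A Q) (hY : IsHarmonicBasis Y)
    (hA : SummabilityCondition A η) {γ : ℝ} (hγ0 : 0 < γ) (hγ1 : γ ≤ 1) (hγη : 2 * γ ≤ η)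
    (s : Finset ℕ) (x y : Sphere2) :
    inner ℝ (Q (evalVec Y s x - evalVec Y s y)) (evalVec Y s x - evalVec Y s y) ≤
      12 / surfaceMeasure.real Set.univ * (∑' ℓ : ℕ, A ℓ * (ℓ : ℝ) ^ (1 + η)) *
        geodesicDist x y ^ (2 * γ) := by
  have e : evalVec Y s x - evalVec Y s y =
      ∑ p ∈ s.sigma fun _ => Finset.univ, (Y p.1 p.2 x - Y p.1 p.2 y) • toL2 (Y p.1 p.2) := by
    rw [evalVec, evalVec, ← Finset.sum_sub_distrib]
    simp only [sub_smul]
  have hσ := surfaceMeasure_real_univ_pos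
  have hd := geodesicDist_nonneg x y
  rw [e]
  refine (hQ.inner_sum hY s (fun p => Y p.1 p.2 x - Y p.1 p.2 y)
    fun p => Y p.1 p.2 x - Y p.1 p.2 y).trans_le ?_
  simp only [← sq]
  have hterm : ∀ ℓ ∈ s, A ℓ * ∑ m, (Y ℓ m x - Y ℓ m y) ^ 2 ≤
      12 / surfaceMeasure.real Set.univ * geodesicDist x y ^ (2 * γ) *
        (A ℓ * (ℓ : ℝ) ^ (1 + η)) := by
    intro ℓ _
    have h1 := hY.sum_sub_sq_le_rpow hγ0 hγ1 ℓ x y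
    have h2 : ((ℓ : ℝ)) ^ (2 * γ) * (2 * ℓ + 1) ≤ 3 * (ℓ : ℝ) ^ (1 + η) := by
      rcases Nat.eq_zero_or_pos ℓ with rfl | hℓ
      · rw [Nat.cast_zero, Real.zero_rpow (by positivity), zero_mul]
        positivity
      · have hℓ' : (1 : ℝ) ≤ ℓ := by exact_mod_cast hℓ
        calc (ℓ : ℝ) ^ (2 * γ) * (2 * ℓ + 1) ≤ (ℓ : ℝ) ^ η * (3 * ℓ) := by
              have := Real.rpow_le_rpow_of_exponent_le hℓ' hγη
              gcongr
              linarith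
          _ = 3 * (ℓ : ℝ) ^ (1 + η) := by
              rw [Real.rpow_add (by positivity), Real.rpow_one]; ring
    rw [Real.mul_rpow (Nat.cast_nonneg _) hd] at h1
    have hA0 := hA.nonneg ℓ
    calc A ℓ * ∑ m, (Y ℓ m x - Y ℓ m y) ^ 2
        ≤ A ℓ * (4 * ((ℓ : ℝ) ^ (2 * γ) * geodesicDist x y ^ (2 * γ)) *
            ((2 * ℓ + 1) / surfaceMeasure.real Set.univ)) := by gcongr
      _ = 4 / surfaceMeasure.real Set.univ * geodesicDist x y ^ (2 * γ) *
            (A ℓ * ((ℓ : ℝ) ^ (2 * γ) * (2 * ℓ + 1))) := by ring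
      _ ≤ 4 / surfaceMeasure.real Set.univ * geodesicDist x y ^ (2 * γ) *
            (A ℓ * (3 * (ℓ : ℝ) ^ (1 + η))) := by gcongr
      _ = _ := by ring
  refine (Finset.sum_le_sum hterm).trans ?_
  rw [← Finset.mul_sum]
  have hs : ∑ ℓ ∈ s, A ℓ * (ℓ : ℝ) ^ (1 + η) ≤ ∑' ℓ : ℕ, A ℓ * (ℓ : ℝ) ^ (1 + η) :=
    hA.summable.sum_le_tsum s fun ℓ _ => mul_nonneg (hA.nonneg ℓ) (by positivity)
  calc _ ≤ 12 / surfaceMeasure.real Set.univ * geodesicDist x y ^ (2 * γ) *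
        ∑' ℓ : ℕ, A ℓ * (ℓ : ℝ) ^ (1 + η) := by gcongr
    _ = _ := by ring

/-- The chord is 2 sin(θ/2); the bounds are sin x ≤ x and Jordan's inequality. -/
lemma dist_le_geodesicDist (x y : Sphere2) : dist x y ≤ geodesicDist x y ∧
    geodesicDist x y ≤ Real.pi / 2 * dist x y := by
  set θ := geodesicDist x y with hθ
  have h0 : 0 ≤ θ := Real.arccos_nonneg _
  have hπ : θ ≤ Real.pi := Real.arccos_le_pi _
  have hx : ‖(x : E3)‖ = 1 := by simp
  have hy : ‖(y : E3)‖ = 1 := by simp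
  have hcos : Real.cos θ = inner ℝ (x : E3) (y : E3) := by
    have h := abs_real_inner_le_norm (x : E3) (y : E3)
    rw [hx, hy, one_mul, abs_le] at h
    exact Real.cos_arccos h.1 h.2
  have hs0 : 0 ≤ Real.sin (θ / 2) :=
    Real.sin_nonneg_of_nonneg_of_le_pi (by linarith) (by linarith)
  have hd : dist x y = 2 * Real.sin (θ / 2) := by
    rw [← sq_eq_sq₀ dist_nonneg (by positivity), Subtype.dist_eq, dist_eq_norm, norm_sub_sq_real,
      hx, hy, ← hcos, mul_pow, Real.sin_sq_eq_half_sub, mul_div_cancel₀ _ (two_ne_zero' ℝ)]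
    ring
  have h1 := Real.sin_le (by linarith : 0 ≤ θ / 2)
  have h2 := Real.mul_le_sin (by linarith : 0 ≤ θ / 2) (by linarith)
  rw [hd]
  refine ⟨by linarith, ?_⟩
  have hpi := Real.pi_pos
  calc θ = Real.pi * (2 / Real.pi * (θ / 2)) := by field_simp
    _ ≤ Real.pi * Real.sin (θ / 2) := by gcongr
    _ = _ := by ring

end

/-! ### The space-time field, its moments and its identification with the process -/

section

section L2Tools

variable {Ω : Type*} [MeasurableSpace Ω] {P : Measure Ω}

lemma lintegral_enorm_sq_eq {W : Ω → ℝ} (hW : MemLp W 2 P) :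
    ∫⁻ ω, ‖W ω‖ₑ ^ 2 ∂P = ENNReal.ofReal (∫ ω, W ω ^ 2 ∂P) := by
  rw [ofReal_integral_eq_lintegral_ofReal hW.integrable_sq (.of_forall fun ω => sq_nonneg _)]
  refine lintegral_congr fun ω => ?_
  rw [← enorm_pow, Real.enorm_of_nonneg (sq_nonneg _)]

lemma eLpNorm_two_le {W : Ω → ℝ} (hW : MemLp W 2 P) {v : ℝ} (hv : 0 ≤ v)
    (h : ∫ ω, W ω ^ 2 ∂P ≤ v) : eLpNorm W 2 P ≤ ENNReal.ofReal √v := by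
  have h1 := eLpNorm_nnreal_pow_eq_lintegral (μ := P) (f := W) (p := 2) two_ne_zero
  have h2 : eLpNorm W 2 P ^ 2 = ∫⁻ ω, ‖W ω‖ₑ ^ 2 ∂P := by
    have e : (((2 : NNReal) : ℝ)) = ((2 : ℕ) : ℝ) := by norm_num
    rw [e] at h1
    simp only [ENNReal.rpow_natCast] at h1
    exact h1
  refine (ENNReal.pow_le_pow_left_iff two_ne_zero).mp ?_
  rw [h2, lintegral_enorm_sq_eq hW, ← ENNReal.ofReal_pow (Real.sqrt_nonneg _), Real.sq_sqrt hv]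
  exact ENNReal.ofReal_le_ofReal h

/-- Moment bounds pass to limits in `L²`. -/
lemma lintegral_enorm_pow_le_of_tendsto_eLpNorm {f : ℕ → Ω → ℝ} {g : Ω → ℝ}
    (hf : ∀ n, AEStronglyMeasurable (f n) P) (hg : AEStronglyMeasurable g P)
    (hfg : Tendsto (fun n => eLpNorm (fun ω => f n ω - g ω) 2 P) atTop (𝓝 0)) {k : ℕ}
    {c : ENNReal} (hc : ∀ᶠ n in atTop, ∫⁻ ω, ‖f n ω‖ₑ ^ k ∂P ≤ c) :
    ∫⁻ ω, ‖g ω‖ₑ ^ k ∂P ≤ c := by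
  -- L² convergence yields an almost surely convergent subsequence, to which Fatou applies.
  obtain ⟨ns, hns, hlim⟩ :=
    (tendstoInMeasure_of_tendsto_eLpNorm two_ne_zero hf hg hfg).exists_seq_tendsto_ae
  calc ∫⁻ ω, ‖g ω‖ₑ ^ k ∂P = ∫⁻ ω, liminf (fun i => ‖f (ns i) ω‖ₑ ^ k) atTop ∂P := by
        refine lintegral_congr_ae ?_
        filter_upwards [hlim] with ω hω
        exact ((ENNReal.continuous_pow k).tendsto _ |>.comp hω.enorm).liminf_eq.symm
    _ ≤ liminf (fun i => ∫⁻ ω, ‖f (ns i) ω‖ₑ ^ k ∂P) atTop :=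
        lintegral_liminf_le' fun i => (hf (ns i)).enorm.pow_const k
    _ ≤ c := by
        refine liminf_le_of_le (by isBoundedDefault) fun b hb => ?_
        obtain ⟨i, h1, h2⟩ := (hb.and (hns.tendsto_atTop.eventually hc)).exists
        exact h1.trans h2

end L2Tools

variable {Y : (ℓ : ℕ) → Order ℓ → C(Sphere2, ℝ)} {A : ℕ → ℝ} {η : ℝ}

/-- The truncated expansion of an element of `L²(𝕊²)`. -/
def truncation (Y : (ℓ : ℕ) → Order ℓ → C(Sphere2, ℝ)) (u : L2Sphere) (L : ℕ) : C(Sphere2, ℝ) :=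
  ∑ p ∈ (Finset.range L).sigma fun _ => Finset.univ,
    (inner ℝ u (toL2 (Y p.1 p.2)) : ℝ) • Y p.1 p.2

lemma truncation_apply (u : L2Sphere) (L : ℕ) (x : Sphere2) :
    truncation Y u L x = inner ℝ u (evalVec Y (Finset.range L) x) := by
  rw [inner_evalVec, truncation, Finset.sum_sigma]
  simp [ContinuousMap.sum_apply]

lemma toL2_truncation (u : L2Sphere) (L : ℕ) :
    toL2 (truncation Y u L) = ∑ p ∈ (Finset.range L).sigma fun _ => Finset.univ,
      (inner ℝ u (toL2 (Y p.1 p.2)) : ℝ) • toL2 (Y p.1 p.2) := by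
  rw [truncation]
  simp only [toL2, map_sum, map_smul]

/-- The truncated expansions of an element of the closed span of the basis converge to it. -/
lemma IsHarmonicBasis.tendsto_truncation (hY : IsHarmonicBasis Y) {u : L2Sphere}
    (hu : ∀ v : L2Sphere, (∀ p : (ℓ : ℕ) × Order ℓ, inner ℝ (toL2 (Y p.1 p.2)) v = 0) →
      inner ℝ u v = 0) :
    Tendsto (fun L => toL2 (truncation Y u L)) atTop (𝓝 u) := by
  set e : (ℓ : ℕ) × Order ℓ → L2Sphere := fun p => toL2 (Y p.1 p.2) with he
  have hsq : Summable fun p => ‖(inner ℝ u (e p) : ℝ)‖ ^ 2 := by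
    have := hY.orthonormal.inner_products_summable (x := u)
    simpa only [real_inner_comm] using this
  have hsum : Summable fun p => (inner ℝ u (e p) : ℝ) • e p := by
    have := (hY.orthonormal.orthogonalFamily.summable_iff_norm_sq_summable
      (fun p => (inner ℝ u (e p) : ℝ))).mpr hsq
    simpa [LinearIsometry.toSpanSingleton_apply] using this
  obtain ⟨c, hc⟩ := hsum
  have hce : ∀ q, inner ℝ c (e q) = inner ℝ u (e q) := by
    intro q
    have h1 : HasSum (fun p => inner ℝ (e q) ((inner ℝ u (e p) : ℝ) • e p)) (inner ℝ (e q) c) :=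
      hc.mapL (innerSL ℝ (e q))
    have h2 := hasSum_single (f := fun p => inner ℝ (e q) ((inner ℝ u (e p) : ℝ) • e p)) q
      fun p hp => by
        have : inner ℝ (e q) (e p) = 0 := hY.orthonormal.2 hp.symm
        rw [inner_smul_right, this, mul_zero]
    have h3 : inner ℝ (e q) (e q) = 1 := by
      rw [real_inner_self_eq_norm_sq, hY.orthonormal.1 q, one_pow]
    rw [inner_smul_right, h3, mul_one] at h2
    rw [real_inner_comm, h1.unique h2]
  -- The residual `u - c` is orthogonal to the harmonics, hence to `u` by hypothesis and to `c` by
  -- expansion, hence to itself.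
  have hperp : ∀ p : (ℓ : ℕ) × Order ℓ, inner ℝ (toL2 (Y p.1 p.2)) (u - c) = 0 := fun p => by
    rw [inner_sub_right, sub_eq_zero, real_inner_comm, real_inner_comm c]
    exact (hce p).symm
  have h1 : inner ℝ u (u - c) = 0 := hu _ hperp
  have h2 : inner ℝ c (u - c) = 0 := by
    have h3 : HasSum (fun p => inner ℝ (u - c) ((inner ℝ u (e p) : ℝ) • e p))
      (inner ℝ (u - c) c) := hc.mapL (innerSL ℝ (u - c))
    have h4 : ∀ p, inner ℝ (u - c) ((inner ℝ u (e p) : ℝ) • e p) = 0 := fun p => by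
      rw [inner_smul_right, real_inner_comm (e p) (u - c), hperp p, mul_zero]
    simp only [h4] at h3
    rw [real_inner_comm, h3.unique hasSum_zero]
  have huc : u = c := by
    rw [← sub_eq_zero, ← inner_self_eq_zero (𝕜 := ℝ), inner_sub_left, h1, h2, sub_zero]
  simp only [toL2_truncation]
  have hc' : HasSum (fun p => (inner ℝ u (e p) : ℝ) • e p) u := by
    conv => arg 2; rw [huc]
    exact hc
  refine hc'.comp (tendsto_atTop_finset_of_monotone (fun a b hab => ?_) fun p =>
    ⟨p.1 + 1, by simp⟩)
  exact Finset.sigma_mono (Finset.range_mono hab) fun _ => le_rfl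

lemma enorm_toL2_sq (f : C(Sphere2, ℝ)) : ‖toL2 f‖ₑ ^ 2 = ∫⁻ x, ‖f x‖ₑ ^ 2 ∂surfaceMeasure := by
  have h1 : ‖toL2 f‖ ^ 2 = ∫ x, f x ^ 2 ∂surfaceMeasure := by
    rw [← real_inner_self_eq_norm_sq, inner_toL2]
    simp only [sq]
  have h2 : ‖toL2 f‖ₑ = ENNReal.ofReal ‖toL2 f‖ := (ofReal_norm _).symm
  have h3 : MemLp f 2 surfaceMeasure := f.continuous.memLp_of_hasCompactSupport
    (HasCompactSupport.of_compactSpace _)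
  rw [lintegral_enorm_sq_eq h3, ← h1, h2, ENNReal.ofReal_pow (norm_nonneg _)]

lemma SummabilityCondition.tendsto_tail (hA : SummabilityCondition A η) (T H : ℝ) :
    Tendsto (fun L => T ^ (2 * H) *
      (∑' ℓ, degreeVariance A ℓ - ∑ ℓ ∈ Finset.range L, degreeVariance A ℓ)) atTop (𝓝 0) := by
  have := (hA.summable_degreeVariance.hasSum.tendsto_sum_nat.const_sub
    (∑' ℓ, degreeVariance A ℓ)).const_mul (T ^ (2 * H))
  simpa using this

variable {Ω : Type*} [MeasurableSpace Ω] {P : Measure Ω} {T H : ℝ} {Q : L2Sphere →L[ℝ] L2Sphere}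
  {B : Set.Icc (0 : ℝ) T → Ω → L2Sphere}

namespace IsQfBm

lemma memLp_partialExpansion (hB : IsQfBm P T H Q B) (L : ℕ) (p : SpaceTime T) :
    MemLp (partialExpansion Y B L p) 2 P := by
  have h : partialExpansion Y B L p =
      fun ω => inner ℝ (B p.1 ω) (evalVec Y (Finset.range L) p.2) :=
    funext fun ω => partialExpansion_eq L p ω
  rw [h]
  exact hB.memLp_inner _ _

/-- The tail variance of the expansion. -/
lemma integral_partialExpansion_sub_sq_le (hB : IsQfBm P T H Q B) (hH : 0 < H)
    (hY : IsHarmonicBasis Y) (hA : SummabilityCondition A η) (hQ : HasAngularPowerSpectrum Y A Q)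
    {L L' : ℕ} (hL : L ≤ L') (p : SpaceTime T) :
    ∫ ω, (partialExpansion Y B L p ω - partialExpansion Y B L' p ω) ^ 2 ∂P ≤
      T ^ (2 * H) * (∑' ℓ, degreeVariance A ℓ - ∑ ℓ ∈ Finset.range L, degreeVariance A ℓ) := by
  have e : ∀ ω, (partialExpansion Y B L p ω - partialExpansion Y B L' p ω) ^ 2 =
      inner ℝ (B p.1 ω) (evalVec Y (Finset.Ico L L') p.2) ^ 2 := by
    intro ω
    rw [inner_evalVec, Finset.sum_Ico_eq_sub _ hL]
    simp only [partialExpansion]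
    ring
  simp only [e]
  rw [hB.integral_inner_sq hH, inner_evalVec_self hQ hY, Finset.sum_Ico_eq_sub _ hL]
  have h1 := hA.summable_degreeVariance.sum_le_tsum (Finset.range L')
    fun ℓ _ => hA.degreeVariance_nonneg ℓ
  have h2 := Finset.sum_le_sum_of_subset_of_nonneg (Finset.range_mono hL)
    fun ℓ _ _ => hA.degreeVariance_nonneg ℓ
  have h0 : (0 : ℝ) ≤ p.1 := p.1.2.1
  have h3 : (p.1 : ℝ) ^ (2 * H) ≤ T ^ (2 * H) := Real.rpow_le_rpow h0 p.1.2.2 (by positivity)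
  have hT : 0 ≤ T := h0.trans p.1.2.2
  exact mul_le_mul h3 (by linarith) (by linarith) (by positivity)

lemma exists_isSpaceTimeField (hB : IsQfBm P T H Q B) (hH : 0 < H) (hT : 0 ≤ T)
    (hY : IsHarmonicBasis Y) (hA : SummabilityCondition A η)
    (hQ : HasAngularPowerSpectrum Y A Q) :
    ∃ X : SpaceTime T → Ω → ℝ, IsSpaceTimeField P Y B X := by
  have hp : ∀ p : SpaceTime T, ∃ f : Ω → ℝ, MemLp f 2 P ∧
      Tendsto (fun L : ℕ => eLpNorm (fun ω => partialExpansion Y B L p ω - f ω) 2 P)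
        atTop (𝓝 0) := by
    intro p
    set v : ℕ → ℝ := fun L => T ^ (2 * H) *
      (∑' ℓ, degreeVariance A ℓ - ∑ ℓ ∈ Finset.range L, degreeVariance A ℓ) with hv
    have hv0 : ∀ L, 0 ≤ v L := fun L => mul_nonneg (by positivity) (sub_nonneg.mpr
      (hA.summable_degreeVariance.sum_le_tsum _ fun ℓ _ => hA.degreeVariance_nonneg ℓ))
    have hmem := fun L => hB.memLp_partialExpansion (Y := Y) L p
    have hcauchy : CauchySeq fun L => (hmem L).toLp (partialExpansion Y B L p) := by
      refine cauchySeq_of_le_tendsto_0' (fun L => √(v L)) (fun n m hnm => ?_) ?_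
      · rw [dist_edist, Lp.edist_toLp_toLp]
        refine ENNReal.toReal_le_of_le_ofReal (Real.sqrt_nonneg _) ?_
        exact eLpNorm_two_le ((hmem n).sub (hmem m)) (hv0 n)
          (hB.integral_partialExpansion_sub_sq_le hH hY hA hQ hnm p)
      · simpa using (hA.tendsto_tail T H).sqrt
    obtain ⟨f, hf⟩ := cauchySeq_tendsto_of_complete hcauchy
    refine ⟨f, Lp.memLp f, ?_⟩
    rw [tendsto_iff_edist_tendsto_0] at hf
    refine hf.congr fun L => ?_
    rw [Lp.edist_def]
    refine eLpNorm_congr_ae ?_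
    filter_upwards [(hmem L).coeFn_toLp] with ω hω
    simp [hω]
  choose X hX using hp
  exact ⟨X, hX⟩

/-- Temporal increments trade the excess exponent 2H - 2γ for a power of T; spatial ones use the
degreewise bound. Uniformity in `L` is what survives the limit. -/
lemma exists_increment_bound (hB : IsQfBm P T H Q B) (hH : 0 < H) (hT : 0 < T)
    (hY : IsHarmonicBasis Y) (hA : SummabilityCondition A η)
    (hQ : HasAngularPowerSpectrum Y A Q) {γ : ℝ} (hγ0 : 0 < γ) (hγ1 : γ ≤ 1) (hγH : γ ≤ H)
    (hγη : 2 * γ ≤ η) :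
    ∃ C : ℝ, 0 ≤ C ∧ ∀ (L : ℕ) (p q : SpaceTime T),
      ∫ ω, (partialExpansion Y B L p ω - partialExpansion Y B L q ω) ^ 2 ∂P ≤
        (C * dist p q ^ γ) ^ 2 := by
  set V := ∑' ℓ, degreeVariance A ℓ with hV
  set S := 12 / surfaceMeasure.real Set.univ * (∑' ℓ : ℕ, A ℓ * (ℓ : ℝ) ^ (1 + η)) with hS
  have hV0 : 0 ≤ V := tsum_nonneg fun ℓ => hA.degreeVariance_nonneg ℓ
  have hS0 : 0 ≤ S := mul_nonneg (div_nonneg (by norm_num) surfaceMeasure_real_univ_pos.le)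
    (tsum_nonneg fun ℓ => mul_nonneg (hA.nonneg ℓ) (by positivity))
  set K : ℝ := 2 * (T ^ (2 * H - 2 * γ) * V) +
    2 * (T ^ (2 * H) * (S * (Real.pi / 2) ^ (2 * γ))) with hK
  have hpi := Real.pi_pos
  have hK0 : 0 ≤ K := by positivity
  refine ⟨√K, Real.sqrt_nonneg _, fun L p q => ?_⟩
  simp only [partialExpansion_eq]
  refine (hB.integral_inner_sub_sq_le hH q.1 p.1 _ _).trans ?_
  rw [inner_evalVec_self hQ hY]
  have h1 := inner_evalVec_sub hQ hY hA hγ0 hγ1 hγη (Finset.range L) p.2 q.2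
  have h2 : ∑ ℓ ∈ Finset.range L, degreeVariance A ℓ ≤ V :=
    hA.summable_degreeVariance.sum_le_tsum _ fun ℓ _ => hA.degreeVariance_nonneg ℓ
  have h2' : 0 ≤ ∑ ℓ ∈ Finset.range L, degreeVariance A ℓ :=
    Finset.sum_nonneg fun ℓ _ => hA.degreeVariance_nonneg ℓ
  set d := dist p q with hd
  have hd0 : 0 ≤ d := dist_nonneg
  have ht : |(p.1 : ℝ) - q.1| ≤ d := by
    rw [hd, Prod.dist_eq, Subtype.dist_eq, Real.dist_eq]
    exact le_max_left _ _
  have hx : dist p.2 q.2 ≤ d := by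
    rw [hd, Prod.dist_eq]
    exact le_max_right _ _
  have htT : |(p.1 : ℝ) - q.1| ≤ T := by
    have hp := p.1.2
    have hq := q.1.2
    rw [abs_le]
    constructor <;> linarith [hp.1, hp.2, hq.1, hq.2]
  have h3 : |(p.1 : ℝ) - q.1| ^ (2 * H) ≤ T ^ (2 * H - 2 * γ) * d ^ (2 * γ) := by
    have e : 2 * H = (2 * H - 2 * γ) + 2 * γ := by ring
    conv_lhs => rw [e, Real.rpow_add_of_nonneg (abs_nonneg _) (by linarith) (by linarith)]
    have a1 := Real.rpow_le_rpow (abs_nonneg _) htT (by linarith : 0 ≤ 2 * H - 2 * γ)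
    have a2 := Real.rpow_le_rpow (abs_nonneg _) ht (by linarith : 0 ≤ 2 * γ)
    gcongr
  have h4 : geodesicDist p.2 q.2 ^ (2 * γ) ≤ (Real.pi / 2) ^ (2 * γ) * d ^ (2 * γ) := by
    rw [← Real.mul_rpow (by positivity) hd0]
    refine Real.rpow_le_rpow (geodesicDist_nonneg _ _) ?_ (by linarith)
    exact (dist_le_geodesicDist _ _).2.trans (by gcongr)
  have h5 : (q.1 : ℝ) ^ (2 * H) ≤ T ^ (2 * H) :=
    Real.rpow_le_rpow q.1.2.1 q.1.2.2 (by positivity)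
  have h6 : (0 : ℝ) ≤ (q.1 : ℝ) ^ (2 * H) := Real.rpow_nonneg q.1.2.1 _
  rw [mul_pow, Real.sq_sqrt hK0]
  have h7 : (d ^ γ) ^ 2 = d ^ (2 * γ) := by
    rw [← Real.rpow_natCast, ← Real.rpow_mul hd0, mul_comm]; rfl
  rw [h7]
  have h8 : |(p.1 : ℝ) - q.1| ^ (2 * H) * ∑ ℓ ∈ Finset.range L, degreeVariance A ℓ ≤
      T ^ (2 * H - 2 * γ) * d ^ (2 * γ) * V := by gcongr
  have h9 : (q.1 : ℝ) ^ (2 * H) * inner ℝ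
      (Q (evalVec Y (Finset.range L) p.2 - evalVec Y (Finset.range L) q.2))
      (evalVec Y (Finset.range L) p.2 - evalVec Y (Finset.range L) q.2) ≤
      T ^ (2 * H) * (S * ((Real.pi / 2) ^ (2 * γ) * d ^ (2 * γ))) := by
    refine (mul_le_mul_of_nonneg_left (h1.trans ?_) h6).trans
      (mul_le_mul_of_nonneg_right h5 (by positivity))
    exact mul_le_mul_of_nonneg_left h4 hS0
  calc _ ≤ 2 * (T ^ (2 * H - 2 * γ) * d ^ (2 * γ) * V) +
        2 * (T ^ (2 * H) * (S * ((Real.pi / 2) ^ (2 * γ) * d ^ (2 * γ)))) := by gcongr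
    _ = K * d ^ (2 * γ) := by rw [hK]; ring

/-- Partial sums are continuous linear functionals of (B(t), B(s)), hence Gaussian; their moment
bounds pass to the limit, whose own law is never needed. -/
lemma exists_moment_bound (hB : IsQfBm P T H Q B) (hH : 0 < H) (hT : 0 < T)
    (hY : IsHarmonicBasis Y) (hA : SummabilityCondition A η)
    (hQ : HasAngularPowerSpectrum Y A Q) {γ : ℝ} (hγ0 : 0 < γ) (hγ1 : γ ≤ 1) (hγH : γ ≤ H)
    (hγη : 2 * γ ≤ η) {X : SpaceTime T → Ω → ℝ} (hX : IsSpaceTimeField P Y B X) (k : ℕ) :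
    ∃ C : ℝ, 0 ≤ C ∧ ∀ p q,
      ∫⁻ ω, ‖X p ω - X q ω‖ₑ ^ k ∂P ≤ ENNReal.ofReal (C * dist p q ^ (γ * k)) := by
  obtain ⟨C, hC, hCX⟩ := hB.exists_increment_bound hH hT hY hA hQ hγ0 hγ1 hγH hγη
  refine ⟨(gaussianMoment k).toReal * C ^ k, by positivity, fun p q => ?_⟩
  have hS : ∀ L p, AEStronglyMeasurable (partialExpansion Y B L p) P := fun L p =>
    (hB.memLp_partialExpansion L p).aestronglyMeasurable
  refine lintegral_enorm_pow_le_of_tendsto_eLpNorm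
    (f := fun L ω => partialExpansion Y B L p ω - partialExpansion Y B L q ω)
    (fun L => (hS L p).sub (hS L q))
    ((hX p).1.aestronglyMeasurable.sub (hX q).1.aestronglyMeasurable) ?_
    (.of_forall fun L => ?_)
  · have h0 := (hX p).2.add (hX q).2
    rw [add_zero] at h0
    refine tendsto_of_tendsto_of_tendsto_of_le_of_le tendsto_const_nhds h0
      (fun _ => zero_le) fun L => ?_
    have e : (fun ω => partialExpansion Y B L p ω - partialExpansion Y B L q ω - (X p ω - X q ω)) =
        (fun ω => partialExpansion Y B L p ω - X p ω) -
          fun ω => partialExpansion Y B L q ω - X q ω := by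
      ext ω
      simp only [Pi.sub_apply]
      ring
    show eLpNorm (fun ω => partialExpansion Y B L p ω - partialExpansion Y B L q ω -
      (X p ω - X q ω)) 2 P ≤ _
    rw [e]
    exact eLpNorm_sub_le ((hS L p).sub (hX p).1.aestronglyMeasurable)
      ((hS L q).sub (hX q).1.aestronglyMeasurable) one_le_two
  · have hmean : ∫ ω, (partialExpansion Y B L p ω - partialExpansion Y B L q ω) ∂P = 0 := by
      simp only [partialExpansion_eq]
      rw [integral_sub (hB.hasGaussianLaw_inner _ _).integrable
        (hB.hasGaussianLaw_inner _ _).integrable, hB.mean, hB.mean, sub_zero]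
    have hlaw : HasGaussianLaw
        (fun ω => partialExpansion Y B L p ω - partialExpansion Y B L q ω) P := by
      simp only [partialExpansion_eq]
      exact hB.hasGaussianLaw_inner_sub q.1 p.1 _ _
    refine (lintegral_enorm_pow_le_of_hasGaussianLaw hlaw hmean (by positivity)
      (hCX L p q) k).trans_eq ?_
    rw [mul_assoc, ENNReal.ofReal_mul ENNReal.toReal_nonneg,
      ENNReal.ofReal_toReal (gaussianMoment_ne_top k), mul_pow, ← Real.rpow_natCast (dist p q ^ γ),
      ← Real.rpow_mul dist_nonneg]

/-- Almost surely, the field lies in the closed span of the spherical harmonics. -/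
lemma ae_inner_eq_zero (hB : IsQfBm P T H Q B) (hH : 0 < H)
    (hQ : HasAngularPowerSpectrum Y A Q) (t : Set.Icc (0 : ℝ) T) :
    ∀ᵐ ω ∂P, ∀ v : L2Sphere, (∀ p : (ℓ : ℕ) × Order ℓ, inner ℝ (toL2 (Y p.1 p.2)) v = 0) →
      inner ℝ (B t ω) v = 0 := by
  set N : Set L2Sphere := {v | ∀ p : (ℓ : ℕ) × Order ℓ, inner ℝ (toL2 (Y p.1 p.2)) v = 0} with hN
  have hne : Nonempty N := ⟨⟨0, fun p => inner_zero_right _⟩⟩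
  have h : ∀ v : N, ∀ᵐ ω ∂P, inner ℝ (B t ω) (v : L2Sphere) = 0 := by
    intro v
    -- So ⟨B(t), v⟩ has variance zero.
    have hQv : Q v = 0 := by
      have h1 := hQ v
      have h2 : ∀ p : (ℓ : ℕ) × Order ℓ, inner ℝ (toL2 (Y p.1 p.2)) (v : L2Sphere) = 0 := v.2
      simp only [h2, mul_zero, zero_smul] at h1
      exact h1.unique hasSum_zero
    have h3 := hB.integral_inner_sq hH t v
    rw [hQv, inner_zero_left, mul_zero,
      integral_eq_zero_iff_of_nonneg (fun _ => sq_nonneg _) (hB.memLp_inner t v).integrable_sq] at h3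
    filter_upwards [h3] with ω hω
    simpa using hω
  -- The null set depends on `v`; separability of L²(𝕊²) and continuity in `v` reduce to countably
  -- many.
  have hall := ae_all_iff.mpr fun n => h (TopologicalSpace.denseSeq N n)
  filter_upwards [hall] with ω hω v hv
  have hcont : Continuous fun w : N => inner ℝ (B t ω) (w : L2Sphere) := by fun_prop
  have heq : (fun w : N => inner ℝ (B t ω) (w : L2Sphere)) = fun _ => 0 :=
    hcont.ext_on (TopologicalSpace.denseRange_denseSeq N) continuous_const (by
      rintro _ ⟨n, rfl⟩
      exact hω n)
  exact congrFun heq ⟨v, hv⟩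

/-- The continuous modification represents the process in `L²(𝕊²)`. -/
lemma ae_modification_eq [IsProbabilityMeasure P] (hB : IsQfBm P T H Q B) (hH : 0 < H)
    (hY : IsHarmonicBasis Y) (hA : SummabilityCondition A η)
    (hQ : HasAngularPowerSpectrum Y A Q) {X Z : SpaceTime T → Ω → ℝ}
    (hX : IsSpaceTimeField P Y B X) (hZm : ∀ p, Measurable (Z p)) (hZX : ∀ p, Z p =ᵐ[P] X p)
    (hZc : ∀ ω, Continuous fun p => Z p ω) (t : Set.Icc (0 : ℝ) T) :
    ∀ᵐ ω ∂P, (fun x : Sphere2 => Z (t, x) ω) =ᵐ[surfaceMeasure] B t ω := by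
  set v : ℕ → ℝ := fun L => T ^ (2 * H) *
    (∑' ℓ, degreeVariance A ℓ - ∑ ℓ ∈ Finset.range L, degreeVariance A ℓ) with hv
  have hBm : AEMeasurable (B t) P := hB.gaussian.aemeasurable t
  -- A Borel version of B(t), needed for the joint measurability behind Tonelli.
  set b : Ω → L2Sphere := hBm.mk (B t) with hb
  have hbm : Measurable b := hBm.measurable_mk
  have hbB : B t =ᵐ[P] b := hBm.ae_eq_mk
  let z : Ω → C(Sphere2, ℝ) := fun ω =>
    ⟨fun x => Z (t, x) ω, (hZc ω).comp (Continuous.prodMk_right t)⟩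
  have hbound : ∀ L x, ∫⁻ ω, ‖truncation Y (b ω) L x - Z (t, x) ω‖ₑ ^ 2 ∂P ≤
      ENNReal.ofReal (v L) := by
    intro L x
    have h1 : ∫⁻ ω, ‖truncation Y (b ω) L x - Z (t, x) ω‖ₑ ^ 2 ∂P =
        ∫⁻ ω, ‖partialExpansion Y B L (t, x) ω - X (t, x) ω‖ₑ ^ 2 ∂P := by
      refine lintegral_congr_ae ?_
      filter_upwards [hbB, hZX (t, x)] with ω h1 h2
      rw [truncation_apply, partialExpansion_eq, h1, h2]
    rw [h1]
    have hS : ∀ L, MemLp (partialExpansion Y B L (t, x)) 2 P := fun L =>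
      hB.memLp_partialExpansion L _
    refine lintegral_enorm_pow_le_of_tendsto_eLpNorm
      (f := fun n ω => partialExpansion Y B L (t, x) ω - partialExpansion Y B n (t, x) ω)
      (fun n => ((hS L).sub (hS n)).aestronglyMeasurable)
      ((hS L).sub (hX (t, x)).1).aestronglyMeasurable ?_ ?_
    · refine (hX (t, x)).2.congr fun n => ?_
      rw [← eLpNorm_neg]
      congr 1
      ext ω
      simp only [Pi.neg_apply, Pi.sub_apply]
      ring
    · filter_upwards [eventually_ge_atTop L] with n hn
      have h2 := lintegral_enorm_sq_eq ((hS L).sub (hS n))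
      simp only [Pi.sub_apply] at h2
      rw [h2]
      exact ENNReal.ofReal_le_ofReal
        (hB.integral_partialExpansion_sub_sq_le hH hY hA hQ hn (t, x))
  have hjoint : ∀ L, Measurable (Function.uncurry fun (x : Sphere2) (ω : Ω) =>
      truncation Y (b ω) L x - Z (t, x) ω) := by
    intro L
    refine measurable_uncurry_of_continuous_of_measurable (fun ω => ?_) fun x => ?_
    · exact (truncation Y (b ω) L).continuous.sub (z ω).continuous
    · refine Measurable.sub ?_ (hZm (t, x))
      simp only [truncation_apply]
      exact (continuous_id.inner continuous_const).measurable.comp hbm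
  have hG : ∀ L, ∫⁻ ω, ‖toL2 (truncation Y (b ω) L - z ω)‖ₑ ^ 2 ∂P ≤
      ENNReal.ofReal (v L) * surfaceMeasure Set.univ := by
    intro L
    simp only [enorm_toL2_sq]
    rw [lintegral_lintegral_swap]
    · refine (lintegral_mono fun x => hbound L x).trans_eq ?_
      rw [lintegral_const]
    · exact (((hjoint L).comp measurable_swap).enorm.pow_const 2).aemeasurable
  have hGmeas : ∀ L, Measurable fun ω => ‖toL2 (truncation Y (b ω) L - z ω)‖ₑ ^ 2 := by
    intro L
    simp only [enorm_toL2_sq]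
    exact (((hjoint L).comp measurable_swap).enorm.pow_const 2).lintegral_prod_right'
  -- Pointwise tail bounds integrate over the sphere to E‖truncation - Z(t,·)‖² → 0, and Fatou makes
  -- the liminf vanish almost surely. The truncations also converge to `b ω`, so both limits agree.
  have hlim : ∫⁻ ω, liminf (fun L => ‖toL2 (truncation Y (b ω) L - z ω)‖ₑ ^ 2) atTop ∂P = 0 := by
    refine le_antisymm ((lintegral_liminf_le hGmeas).trans ?_) zero_le
    have h1 : Tendsto (fun L => ENNReal.ofReal (v L) * surfaceMeasure Set.univ) atTop (𝓝 0) := by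
      have h2 := ENNReal.tendsto_ofReal (hA.tendsto_tail T H)
      rw [ENNReal.ofReal_zero] at h2
      have h3 := ENNReal.Tendsto.mul_const (b := surfaceMeasure Set.univ) h2
        (Or.inr (measure_ne_top _ _))
      rwa [zero_mul] at h3
    rw [← h1.liminf_eq]
    exact liminf_le_liminf (.of_forall hG)
  rw [lintegral_eq_zero_iff (Measurable.liminf hGmeas)] at hlim
  filter_upwards [hlim, hbB, hB.ae_inner_eq_zero hH hQ t] with ω h1 h2 h3
  rw [h2] at h3
  have h4 := ((hY.tendsto_truncation h3).sub_const (toL2 (z ω))).enorm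
  have h5 := ((ENNReal.continuous_pow 2).tendsto _).comp h4
  have h6 : ‖b ω - toL2 (z ω)‖ₑ ^ 2 = 0 := by
    rw [← h5.liminf_eq]
    refine Eq.trans ?_ h1
    refine liminf_congr (.of_forall fun L => ?_)
    simp only [Function.comp_apply]
    rw [toL2_sub]
  have h7 : b ω = toL2 (z ω) := by
    rw [← sub_eq_zero]
    simpa using h6
  rw [h2, h7]
  exact (ContinuousMap.coeFn_toLp (p := 2) (𝕜 := ℝ) surfaceMeasure (z ω)).symm

end IsQfBm

lemma dist_le_distM (p q : SpaceTime T) : dist p q ≤ distM p q := by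
  rw [Prod.dist_eq, Subtype.dist_eq, Real.dist_eq, distM]
  have h1 := (dist_le_geodesicDist p.2 q.2).1
  have h2 := geodesicDist_nonneg p.2 q.2
  exact max_le (by linarith) (by linarith [abs_nonneg ((p.1 : ℝ) - q.1)])

/-- Time and the three Cartesian coordinates embed the domain in a cube; the constant 2 absorbs √3.
-/
lemma exists_nets_spaceTime (hT : 0 < T) :
    ∃ (π : ℕ → SpaceTime T → SpaceTime T) (N : ℕ → Finset (SpaceTime T)) (C₀ K : ℝ),
      (∀ n x, dist x (π n x) ≤ 2 * (1 / 2) ^ n) ∧ (∀ n x, π n x ∈ N n) ∧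
      ∀ n, ((N n).card : ℝ) ≤ C₀ * K ^ n := by
  have : Nonempty (SpaceTime T) :=
    ⟨(⟨0, le_rfl, hT.le⟩, ⟨EuclideanSpace.single 0 1, by simp⟩)⟩
  refine exists_nets (d := 4) (fun p => Fin.cons (p.1 : ℝ) fun i => (p.2 : E3) i)
    (R := max T 1) (by positivity) (fun p i => ?_) fun p q δ h => ?_
  · refine Fin.cases ?_ (fun j => ?_) i
    · simp only [Fin.cons_zero]
      rw [abs_of_nonneg p.1.2.1]
      exact p.1.2.2.trans (le_max_left _ _)
    · simp only [Fin.cons_succ]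
      have h1 := PiLp.norm_apply_le (p.2 : E3) j
      have h2 : ‖(p.2 : E3)‖ = 1 := by simp
      rw [h2] at h1
      exact h1.trans (le_max_right _ _)
  · have h0 : |(p.1 : ℝ) - q.1| ≤ δ := by simpa using h 0
    have hδ : 0 ≤ δ := (abs_nonneg _).trans h0
    rw [Prod.dist_eq, Subtype.dist_eq, Real.dist_eq]
    refine max_le (by linarith) ?_
    rw [Subtype.dist_eq, EuclideanSpace.dist_eq]
    refine Real.sqrt_le_iff.mpr ⟨by linarith, ?_⟩
    have h3 : ∀ i : Fin 3, dist ((p.2 : E3) i) ((q.2 : E3) i) ^ 2 ≤ δ ^ 2 := fun i => by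
      have := h i.succ
      simp only [Fin.cons_succ] at this
      rw [Real.dist_eq]
      gcongr
    calc _ ≤ ∑ _i : Fin 3, δ ^ 2 := Finset.sum_le_sum fun i _ => h3 i
      _ ≤ (2 * δ) ^ 2 := by
        simp only [Finset.sum_const, Finset.card_univ, Fintype.card_fin, nsmul_eq_mul]
        push_cast
        nlinarith [sq_nonneg δ]

lemma dist_spaceTime_le (p q : SpaceTime T) : dist p q ≤ max T 2 := by
  rw [Prod.dist_eq, Subtype.dist_eq, Real.dist_eq]
  refine max_le_max ?_ ?_
  · rw [abs_le]
    constructor <;> linarith [p.1.2.1, p.1.2.2, q.1.2.1, q.1.2.2]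
  · have := dist_triangle_right (p.2 : E3) q.2 0
    rw [Subtype.dist_eq]
    simp only [dist_zero_right] at this
    have h1 : ‖(p.2 : E3)‖ = 1 := by simp
    have h2 : ‖(q.2 : E3)‖ = 1 := by simp
    linarith

end

end QfBm

end

theorem corollary3p6 {Ω : Type*} [MeasurableSpace Ω] (P : Measure Ω) [IsProbabilityMeasure P]
    (T H η : ℝ) (hT : 0 < T) (hH0 : 0 < H) (hH1 : H < 1)
    (Y : (ℓ : ℕ) → QfBm.Order ℓ → C(QfBm.Sphere2, ℝ)) (hY : QfBm.IsHarmonicBasis Y)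
    (A : ℕ → ℝ) (hA : QfBm.SummabilityCondition A η)
    (Q : QfBm.L2Sphere →L[ℝ] QfBm.L2Sphere) (hQ : QfBm.HasAngularPowerSpectrum Y A Q)
    (B : Set.Icc (0 : ℝ) T → Ω → QfBm.L2Sphere) (hB : QfBm.IsQfBm P T H Q B) :
    (∃ X : QfBm.SpaceTime T → Ω → ℝ, QfBm.IsSpaceTimeField P Y B X) ∧
    ∀ X : QfBm.SpaceTime T → Ω → ℝ, QfBm.IsSpaceTimeField P Y B X →
      ∃ Z : QfBm.SpaceTime T → Ω → ℝ,
        QfBm.IsModification P Z X ∧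
        (∀ ω, Continuous (fun p => Z p ω) ∧
          ∀ α : ℝ, 0 < α → α < min H (η / 2) → QfBm.IsHolderM α (fun p => Z p ω)) ∧
        (∀ t : Set.Icc (0 : ℝ) T, ∀ᵐ ω ∂P,
          (fun x : QfBm.Sphere2 => Z (t, x) ω) =ᵐ[QfBm.surfaceMeasure] B t ω) := by
  refine ⟨hB.exists_isSpaceTimeField hH0 hT.le hY hA hQ, fun X hX => ?_⟩
  have hη := hA.pos
  set γ := min H (η / 2) with hγ
  have hγ0 : 0 < γ := lt_min hH0 (by positivity)
  have hγH : γ ≤ H := min_le_left _ _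
  have hγη : 2 * γ ≤ η := by linarith [min_le_right H (η / 2)]
  obtain ⟨π, N, C₀, K, hπ, hπN, hN⟩ := QfBm.exists_nets_spaceTime hT
  -- The field is only almost everywhere measurable at each point, whereas chaining requires
  -- measurable variables.
  set X' : QfBm.SpaceTime T → Ω → ℝ := fun p => (hX p).1.aestronglyMeasurable.mk (X p) with hX'
  have hX'm : ∀ p, Measurable (X' p) := fun p =>
    (hX p).1.aestronglyMeasurable.stronglyMeasurable_mk.measurable
  have hXX' : ∀ p, X p =ᵐ[P] X' p := fun p => (hX p).1.aestronglyMeasurable.ae_eq_mk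
  have hmom : ∀ k : ℕ, ∃ C : ℝ, 0 ≤ C ∧ ∀ p q,
      ∫⁻ ω, ‖X' p ω - X' q ω‖ₑ ^ k ∂P ≤ ENNReal.ofReal (C * dist p q ^ (γ * k)) := fun k => by
    obtain ⟨C, hC, hCX⟩ :=
      hB.exists_moment_bound hH0 hT hY hA hQ hγ0 (hγH.trans hH1.le) hγH hγη hX k
    refine ⟨C, hC, fun p q => (lintegral_congr_ae ?_).trans_le (hCX p q)⟩
    filter_upwards [hXX' p, hXX' q] with ω h1 h2
    rw [h1, h2]
  obtain ⟨Z, hZm, hZX', hZα⟩ := QfBm.exists_holder_modification hX'm hγ0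
    (lt_max_of_lt_left hT : 0 < max T 2) hmom QfBm.dist_spaceTime_le
    (fun n x => (hπ n x).trans (by gcongr; exact le_max_right _ _)) hπN hN
  have hZX : ∀ p, Z p =ᵐ[P] X p := fun p => (hZX' p).trans (hXX' p).symm
  have hZc : ∀ ω, Continuous fun p => Z p ω := fun ω => by
    -- Any exponent strictly between 0 and γ gives continuity.
    obtain ⟨C, hC⟩ := hZα ω (γ / 2) (by linarith) (by linarith)
    have hlim : ∀ p, Tendsto (fun q => C * dist q p ^ (γ / 2)) (𝓝 p) (𝓝 0) := fun p => by
      have h1 : Continuous fun q : QfBm.SpaceTime T => C * dist q p ^ (γ / 2) :=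
        continuous_const.mul ((continuous_id.dist continuous_const).rpow_const
          fun _ => Or.inr (by linarith))
      have h2 := h1.tendsto p
      rwa [dist_self, Real.zero_rpow (by linarith), mul_zero] at h2
    refine continuous_iff_continuousAt.mpr fun p => ?_
    rw [ContinuousAt, tendsto_iff_dist_tendsto_zero]
    refine squeeze_zero (fun _ => dist_nonneg) (fun q => ?_) (hlim p)
    rw [Real.dist_eq]
    exact hC q p
  refine ⟨Z, ⟨hZm, hZX⟩, fun ω => ⟨hZc ω, fun α hα hαγ => ?_⟩,
    hB.ae_modification_eq hH0 hY hA hQ hX hZm hZX hZc⟩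
  obtain ⟨C, hC⟩ := hZα ω α hα hαγ
  refine ⟨|C|, fun p q => (hC p q).trans ?_⟩
  calc C * dist p q ^ α ≤ |C| * dist p q ^ α := by
        gcongr
        exact le_abs_self C
    _ ≤ |C| * QfBm.distM p q ^ α := by
        have := QfBm.dist_le_distM p q
        gcongr
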